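/- Let $X$ be a nonsingular projective curve with finite field of constants $\mathbf{F}_q$, let $\infty$ be a closed point of $X$, and let $\mathbf{A}=\Gamma(X\setminus\{\infty\},\mathcal{O}_X)$. For $0\neq a\in\mathbf{A}$ put $\deg a=\dim_{\mathbf{F}_q}\mathbf{A}/(a)$. Let $\gamma:S\to\operatorname{Spec}\mathbf{A}$ be a connected, locally noetherian $\mathbf{A}$-scheme, with induced ring morphism $\gamma^\sharp:\mathbf{A}\to\Gamma(S,\mathcal{O}_S)$. For an invertible sheaf $\mathcal{L}$ on $S$ let $\mathbf{G}_{a,\mathcal{L}}$ be the line bundle over $S$ representing $(f:T\to S)\mapsto H^0(T,f^*\mathcal{L})$; it is a group scheme with an action of $\mathbf{F}_q$. A Drinfeld module of rank $r>0$ over $S$ is a pair $\mathcal{E}=(\mathcal{L},\phi)$ of an invertible sheaf $\mathcal{L}$ and an $\mathbf{F}_q$-linear ring morphism $\phi:\mathbf{A}\to\operatorname{End}_{\mathbf{F}_q}(\mathbf{G}_{a,\mathcal{L}})$, $a\mapsto\phi_a$, such that for every non-zero $a\in\mathbf{A}$ the derivative of $\phi_a$ at $0$ (the coefficient $x_0$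 when $\phi_a$ is written locally as $x_0X+x_1X^q+x_2X^{q^2}+\cdots$) is $\gamma^\sharp(a)$, and $\phi_a$ is finite and flat of rank $q^{r\deg a}$. An isogeny of Drinfeld modules is a finite morphism of group schemes over $S$ compatible with the actions of $\mathbf{A}$. Let $\mathcal{E}=(\mathcal{L},\phi)$ be a Drinfeld module of rank $r$ over $S$, and let $G\subset\mathbf{G}_{a,\mathcal{L}}$ be a closed $\mathbf{A}$-invariant subgroup scheme, finite and flat over $S$. Over an affine open $U=\operatorname{Spec}R$ of $S$ on which $\mathcal{L}$ is trivialized, $G$ is the zero locus in $\mathbf{G}_{a,R}=\operatorname{Spec}R[X]$ of a unique monic polynomial $P$, which describes the quotient morphism by $G$ over $U$; let $x_i$ be the coefficient of $X^{q^i}$ in $P$. Suppose that $G$ has height $h$: $h$ is the smallest index for which $x_h$ is non-zero (that is, non-zero for some such $U$ and trivialization). Suppose moreover that $x_h$ is not a zero divisor, i.e. that for every such $U$ and trivialization it is not a zero divisor in $R$ (this is automatic if $S$ is integral). Then there exist a Drinfeld module $\mathcal{F}$ of rank $r$ over $S$ and an isogeny $\xi:\mathcal{E}\to\mathcal{F}$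 with kernel $G$ if and only if $$\gamma^\sharp(a^{q^h})=\gamma^\sharp(a)\qquad\text{for all } a\in\mathbf{A}.$$ -/

import Mathlib

open CategoryTheory AlgebraicGeometry

universe u

/-! Line bundles over a scheme -/

/-- A (geometric) line bundle `𝔾_{a,𝓛}` over `S`, given through its functor of points on `Sch/S`:
an `S`-scheme `total` such that `T ↦ Hom_S(T, total)` is a functor in modules over
`T ↦ Γ(T, 𝒪_T)` which, locally on `S`, is free of rank one on one generator
(so that `T ↦ Hom_S(T, total)` is `T ↦ Γ(T, f^* 𝓛)` for an invertible sheaf `𝓛`). -/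
structure LineBundle (S : Scheme.{u}) where
  /-- the underlying `S`-scheme -/
  total : Over S
  addCommGroup : ∀ T : Over S, AddCommGroup (T ⟶ total)
  module : ∀ T : Over S, Module Γ(T.left, ⊤) (T ⟶ total)
  comp_add : ∀ {T T' : Over S} (g : T' ⟶ T) (x y : T ⟶ total),
    g ≫ (x + y) = g ≫ x + g ≫ y
  comp_smul : ∀ {T T' : Over S} (g : T' ⟶ T) (c : Γ(T.left, ⊤)) (x : T ⟶ total),
    g ≫ (c • x) = (g.left.appTop.hom c) • (g ≫ x)
  exists_frame : ∀ s : S, ∃ U : S.Opens, s ∈ U ∧ IsAffineOpen U ∧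
    ∃ e : Over.mk U.ι ⟶ total, ∀ (T : Over S) (g : T ⟶ Over.mk U.ι),
      Function.Bijective fun c : Γ(T.left, ⊤) => c • (g ≫ e)

attribute [instance] LineBundle.addCommGroup LineBundle.module

namespace LineBundle

variable {S : Scheme.{u}}

/-- A frame of `V` over the open `U`: a section `e` over `U` such that `c ↦ c • e` is an
isomorphism from the additive group over `U` to the restriction of `V` to `U`. -/
structure Frame (V : LineBundle S) (U : S.Opens) where
  sec : Over.mk U.ι ⟶ V.total
  bijective : ∀ (T : Over S) (g : T ⟶ Over.mk U.ι),
    Function.Bijective fun c : Γ(T.left, ⊤) => c • (g ≫ sec)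

/-- A morphism of `S`-schemes between line bundles is a morphism of group schemes. -/
def IsGroupHom {V W : LineBundle S} (f : V.total ⟶ W.total) : Prop :=
  ∀ (T : Over S) (x y : T ⟶ V.total), (x + y) ≫ f = x ≫ f + y ≫ f

/-- With respect to the frames `e` of `V` and `e'` of `W` over `U`, the morphism `f` is the
polynomial map `c ↦ P(c)`. (For an affine `U` there is exactly one such `P`; it is
`∑ xᵢ X ^ (q ^ i)`, that is `∑ xᵢ τ ^ i`, if `f` is an `𝔽_q`-linear morphism of group schemes.) -/
def IsLocalExpr {V W : LineBundle S} (f : V.total ⟶ W.total) {U : S.Opens}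
    (e : V.Frame U) (e' : W.Frame U) (P : Polynomial Γ(U, ⊤)) : Prop :=
  ∀ (T : Over S) (g : T ⟶ Over.mk U.ι) (c : Γ(T.left, ⊤)),
    (c • (g ≫ e.sec)) ≫ f = (P.eval₂ g.left.appTop.hom c) • (g ≫ e'.sec)

/-- The derivative at `0` of the endomorphism `f` of `V` is the global function `c`: in every
local expression `x₀ X + ⋯` of `f`, the coefficient `x₀` is the restriction of `c`. -/
def HasDerivativeAtZero {V : LineBundle S} (f : V.total ⟶ V.total) (c : Γ(S, ⊤)) : Prop :=
  ∀ (U : S.Opens), IsAffineOpen U → ∀ (e : V.Frame U) (P : Polynomial Γ(U, ⊤)),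
    IsLocalExpr f e e P → P.coeff 1 = U.ι.appTop.hom c

/-- A closed subgroup scheme of (the group scheme underlying) a line bundle. -/
structure ClosedSubgroup (V : LineBundle S) where
  obj : Over S
  incl : obj ⟶ V.total
  isClosedImmersion : IsClosedImmersion incl.left
  exists_zero : ∀ T : Over S, ∃ z : T ⟶ obj, z ≫ incl = 0
  exists_add : ∀ (T : Over S) (x y : T ⟶ obj), ∃ z : T ⟶ obj, z ≫ incl = x ≫ incl + y ≫ incl
  exists_neg : ∀ (T : Over S) (x : T ⟶ obj), ∃ z : T ⟶ obj, z ≫ incl = -(x ≫ incl)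

/-- `G` is the kernel of `f`, as a functor of points. -/
def ClosedSubgroup.IsKernel {V W : LineBundle S} (G : V.ClosedSubgroup)
    (f : V.total ⟶ W.total) : Prop :=
  ∀ (T : Over S) (x : T ⟶ V.total), (∃ y : T ⟶ G.obj, y ≫ G.incl = x) ↔ x ≫ f = 0

/-- With respect to the frame `e` of `V` over `U`, the subgroup `G` is the zero locus of the monic
polynomial `P`. (For a finite flat `G` of constant rank and an affine `U` there is exactly one
such `P`, and the quotient morphism `V → V/G` is locally given by `c ↦ P(c)`.) -/
def ClosedSubgroup.IsLocalEquation {V : LineBundle S} (G : V.ClosedSubgroup) {U : S.Opens}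
    (e : V.Frame U) (P : Polynomial Γ(U, ⊤)) : Prop :=
  P.Monic ∧ ∀ (T : Over S) (g : T ⟶ Over.mk U.ι) (c : Γ(T.left, ⊤)),
    (∃ y : T ⟶ G.obj, y ≫ G.incl = c • (g ≫ e.sec)) ↔ P.eval₂ g.left.appTop.hom c = 0

/-- In the quotient morphism `V → V/G`, locally written as `∑ xᵢ X ^ (q ^ i) = ∑ xᵢ τ ^ i`,
the coefficient `xᵢ` is zero. -/
def ClosedSubgroup.CoeffEqZero {V : LineBundle S} (G : V.ClosedSubgroup) (q i : ℕ) : Prop :=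
  ∀ (U : S.Opens), IsAffineOpen U → ∀ (e : V.Frame U) (P : Polynomial Γ(U, ⊤)),
    G.IsLocalEquation e P → P.coeff (q ^ i) = 0

/-- In the quotient morphism `V → V/G`, locally written as `∑ xᵢ X ^ (q ^ i) = ∑ xᵢ τ ^ i`,
the coefficient `xᵢ` is regular, i.e. not a zero divisor. -/
def ClosedSubgroup.CoeffRegular {V : LineBundle S} (G : V.ClosedSubgroup) (q i : ℕ) : Prop :=
  ∀ (U : S.Opens), IsAffineOpen U → ∀ (e : V.Frame U) (P : Polynomial Γ(U, ⊤)),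
    G.IsLocalEquation e P → P.coeff (q ^ i) ∈ nonZeroDivisors (Γ(U, ⊤) : Type u)

/-- `h` is the height of `G`, that is of the quotient morphism `V → V/G`: the smallest index
with `x_h ≠ 0`. -/
def ClosedSubgroup.HasHeight {V : LineBundle S} (G : V.ClosedSubgroup) (q h : ℕ) : Prop :=
  (∀ i < h, G.CoeffEqZero q i) ∧ ¬ G.CoeffEqZero q h

end LineBundle

/-! Drinfeld modules -/

/-- `A` is the `𝔽_q`-algebra of functions on `X ∖ {∞}`, for a nonsingular projective curve `X`
with field of constants `𝔽_q` and a closed point `∞` of `X`. -/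
def IsCurveCoordinateRing (Fq : Type u) [Field Fq] (A : Type u) [CommRing A] [Algebra Fq A] :
    Prop :=
  ∃ (X : Scheme.{u}) (p : X ⟶ Spec (CommRingCat.of Fq)) (infty : X)
    (hc : IsClosed ({infty} : Set X)),
    IsIntegral X ∧ IsProper p ∧ SmoothOfRelativeDimension 1 p ∧
    Function.Bijective (p.appTop.hom.comp (Scheme.ΓSpecIso (CommRingCat.of Fq)).inv.hom) ∧
    ∃ e : A ≃+* Γ(X, (⟨{infty}ᶜ, hc.isOpen_compl⟩ : X.Opens)),
      ∀ c : Fq, e (algebraMap Fq A c) =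
        (X.presheaf.map (homOfLE le_top).op).hom
          (p.appTop.hom ((Scheme.ΓSpecIso (CommRingCat.of Fq)).inv.hom c))

/-- The ring morphism `γ^♯ : A → Γ(S, 𝒪_S)` of an `A`-scheme `γ : S ⟶ Spec A`. -/
noncomputable def gammaSharp {A : Type u} [CommRing A] {S : Scheme.{u}}
    (γ : S ⟶ Spec (CommRingCat.of A)) : A →+* Γ(S, ⊤) :=
  γ.appTop.hom.comp (Scheme.ΓSpecIso (CommRingCat.of A)).inv.hom

/-- A morphism of group schemes between line bundles over the `A`-scheme `S` that commutes
with the action of `𝔽_q ⊆ A`. -/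
def IsFqLinearHom (Fq : Type u) [Field Fq] {A : Type u} [CommRing A] [Algebra Fq A]
    {S : Scheme.{u}} (γ : S ⟶ Spec (CommRingCat.of A)) {V W : LineBundle S}
    (f : V.total ⟶ W.total) : Prop :=
  LineBundle.IsGroupHom f ∧
  ∀ (c : Fq) (T : Over S) (x : T ⟶ V.total),
    (gammaSharp (T.hom ≫ γ) (algebraMap Fq A c) • x) ≫ f =
      gammaSharp (T.hom ≫ γ) (algebraMap Fq A c) • (x ≫ f)

/-- A Drinfeld module of rank `r` over the `A`-scheme `γ : S ⟶ Spec A`: a line bundle with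
an `𝔽_q`-linear ring morphism `a ↦ φ_a` from `A` to its ring of `𝔽_q`-linear endomorphisms. -/
structure DrinfeldModule (Fq : Type u) [Field Fq] [Fintype Fq] {A : Type u} [CommRing A]
    [Algebra Fq A] {S : Scheme.{u}} (γ : S ⟶ Spec (CommRingCat.of A)) (r : ℕ) where
  rank_pos : 0 < r
  bundle : LineBundle S
  /-- the endomorphism `φ_a` -/
  act : A → (bundle.total ⟶ bundle.total)
  isFqLinearHom : ∀ a, IsFqLinearHom Fq γ (act a)
  act_one : act 1 = 𝟙 bundle.total
  act_mul : ∀ a b, act (a * b) = act b ≫ act a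
  act_add : ∀ (a b : A) (T : Over S) (x : T ⟶ bundle.total),
    x ≫ act (a + b) = x ≫ act a + x ≫ act b
  act_algebraMap : ∀ (c : Fq) (T : Over S) (x : T ⟶ bundle.total),
    x ≫ act (algebraMap Fq A c) = gammaSharp (T.hom ≫ γ) (algebraMap Fq A c) • x
  derivative : ∀ a, a ≠ 0 → LineBundle.HasDerivativeAtZero (act a) (gammaSharp γ a)
  finite : ∀ a, a ≠ 0 → IsFinite (act a).left
  flat : ∀ a, a ≠ 0 → Flat (act a).left
  finrank_eq : ∀ a, a ≠ 0 → ∀ y, (act a).left.finrank y =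
    Fintype.card Fq ^ (r * Module.finrank Fq (A ⧸ Ideal.span {a}))

section

variable {Fq : Type u} [Field Fq] [Fintype Fq] {A : Type u} [CommRing A] [Algebra Fq A]
  {S : Scheme.{u}} {γ : S ⟶ Spec (CommRingCat.of A)}

/-- An isogeny of Drinfeld modules: a finite morphism of group schemes compatible with the
action of `A`. -/
structure Isogeny {r : ℕ} (E F : DrinfeldModule Fq γ r) where
  hom : E.bundle.total ⟶ F.bundle.total
  isGroupHom : LineBundle.IsGroupHom hom
  finite : IsFinite hom.left
  comm : ∀ a : A, E.act a ≫ hom = hom ≫ F.act a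

/-- `G` is stable under the action of `A`. -/
def LineBundle.ClosedSubgroup.IsInvariant {r : ℕ} {E : DrinfeldModule Fq γ r}
    (G : E.bundle.ClosedSubgroup) : Prop :=
  ∀ (a : A) (T : Over S) (x : T ⟶ G.obj), ∃ y : T ⟶ G.obj, y ≫ G.incl = (x ≫ G.incl) ≫ E.act a

end

/-!
In a local coordinate of `𝓛` the quotient by `G` has to be `c ↦ P(c)`, with `P` the monic equation
of `G`. That `G` is a subgroup makes `P` additive, hence of degree `p ^ k`, and that `G` is
`𝔽_q`-stable makes `P` `𝔽_q`-linear because `x_h` is regular. Changing the coordinate by a unit `u`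
multiplies `P` by `u ^ p ^ k`, so the maps `P` glue to a morphism from `𝓛` to its Frobenius twist.

Since `G` is `A`-invariant, `P` divides `P ∘ φ_a`, and right division of additive polynomials
gives a unique `ψ_a` with `P ∘ φ_a = ψ_a ∘ P`. The lowest terms of the two sides are
`x_h γ(a) ^ q ^ h` and `ψ_a'(0) x_h`; as `x_h` is regular, `ψ_a` has derivative `γ(a) ^ q ^ h`
at `0`. Thus the action of `A` on the quotient is a Drinfeld module over `γ` exactly when
`γ(a) ^ q ^ h = γ(a)` for all `a`. An arbitrary isogeny with kernel `G` is locally a unit multiple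
of `P`, so the same comparison applies to it.
-/

/-! ### Additive polynomials -/

namespace AdditivePolynomial

open Polynomial

variable {R : Type u} [CommRing R]

/-- A polynomial is *additive* if it induces additive maps on all `R`-algebras, that is, if it
defines an endomorphism of the group scheme `𝔾_a` over `R`. -/
def IsAdditive (f : R[X]) : Prop :=
  ∀ ⦃R' : Type u⦄ [CommRing R'] (φ : R →+* R') (x y : R'),
    f.eval₂ φ (x + y) = f.eval₂ φ x + f.eval₂ φ y

lemma isAdditive_X : IsAdditive (X : R[X]) := fun _ _ _ _ _ => by simp

namespace IsAdditive

variable {f g : R[X]}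

lemma zero : IsAdditive (0 : R[X]) := fun _ _ _ _ _ => by simp

lemma add (hf : IsAdditive f) (hg : IsAdditive g) : IsAdditive (f + g) := fun _ _ φ x y => by
  rw [eval₂_add, eval₂_add, eval₂_add, hf φ x y, hg φ x y, add_add_add_comm]

lemma sub (hf : IsAdditive f) (hg : IsAdditive g) : IsAdditive (f - g) := fun _ _ φ x y => by
  rw [eval₂_sub, eval₂_sub, eval₂_sub, hf φ x y, hg φ x y, add_sub_add_comm]

lemma C_mul (hf : IsAdditive f) (a : R) : IsAdditive (C a * f) := fun _ _ φ x y => by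
  simp only [eval₂_mul, eval₂_C, hf φ x y, mul_add]

lemma comp (hf : IsAdditive f) (hg : IsAdditive g) : IsAdditive (f.comp g) := fun _ _ φ x y => by
  simp only [eval₂_comp, hg φ x y, hf φ]

lemma pow_char_pow {p : ℕ} (hp : p.Prime) (hR : (p : R) = 0) (hf : IsAdditive f) (i : ℕ) :
    IsAdditive (f ^ p ^ i) := fun R' _ φ x y => by
  rcases subsingleton_or_nontrivial R' with _ | _
  · exact Subsingleton.elim _ _
  have : Fact p.Prime := ⟨hp⟩
  have : CharP R' p := (CharP.charP_iff_prime_eq_zero hp).2 (by rw [← map_natCast φ, hR, map_zero])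
  rw [eval₂_pow, eval₂_pow, eval₂_pow, hf φ x y, add_pow_char_pow]

lemma sum {ι : Type*} {s : Finset ι} {f : ι → R[X]} (hf : ∀ i ∈ s, IsAdditive (f i)) :
    IsAdditive (∑ i ∈ s, f i) :=
  Finset.sum_induction _ _ (fun _ _ => add) zero hf

lemma of_coeff {p : ℕ} (hp : p.Prime) (hR : (p : R) = 0)
    (hf : ∀ m, f.coeff m ≠ 0 → ∃ i, m = p ^ i) : IsAdditive f := by
  rw [f.as_sum_support_C_mul_X_pow]
  refine sum fun m hm => ?_
  obtain ⟨i, rfl⟩ := hf m (mem_support_iff.1 hm)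
  exact (isAdditive_X.pow_char_pow hp hR i).C_mul _

lemma coeff_zero (hf : IsAdditive f) : f.coeff 0 = 0 := by
  simpa [coeff_zero_eq_eval_zero] using hf (RingHom.id R) 0 0

end IsAdditive

lemma map_hasseDeriv {R' : Type*} [CommRing R'] (φ : R →+* R') (f : R[X]) (j : ℕ) :
    (hasseDeriv j f).map φ = hasseDeriv j (f.map φ) := by
  ext m
  simp [hasseDeriv_coeff]

/-- Expanding `f(X + Y)`, the equations on Hasse derivatives say `f(X + Y) = f(X) + f(Y)`; then
`f.coeff m` is killed by every `m.choose i` with `0 < i < m`, and these are not all divisible by `p`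
unless `m` is a power of `p`. -/
lemma exists_eq_pow_of_hasseDeriv {p : ℕ} (hp : p.Prime) (hR : (p : R) = 0) {f : R[X]}
    (h0 : f.coeff 0 = 0) (hf : ∀ j ≠ 0, hasseDeriv j f = C (f.coeff j)) {m : ℕ}
    (hm : f.coeff m ≠ 0) : ∃ i, m = p ^ i := by
  have : Fact p.Prime := ⟨hp⟩
  have hm0 : 0 < m := Nat.pos_of_ne_zero (by rintro rfl; exact hm h0)
  refine ⟨_, Choose.eq_pow_multiplicity_of_choose_modEq_zero_nat hm0 fun i hi => ?_⟩
  rw [Finset.mem_Icc] at hi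
  rw [Nat.modEq_zero_iff_dvd]
  by_contra hndvd
  have hunit : IsUnit ((m.choose i : ℕ) : R) := by
    have hcoprime := ((hp.coprime_iff_not_dvd).2 hndvd).cast (R := R)
    rwa [hR, isCoprime_zero_left] at hcoprime
  have hchoose : ((m.choose i : ℕ) : R) * f.coeff m = 0 := by
    have h := congrArg (coeff · (m - i)) (hf i (by omega))
    simpa only [hasseDeriv_coeff, coeff_C, show m - i ≠ 0 by omega, if_false,
      Nat.sub_add_cancel (show i ≤ m by omega)] using h
  exact hm (hunit.mul_right_eq_zero.1 hchoose)

lemma IsAdditive.hasseDeriv_eq {f : R[X]} (hf : IsAdditive f) {j : ℕ} (hj : j ≠ 0) :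
    hasseDeriv j f = C (f.coeff j) := by
  have htaylor : taylor (X : R[X]) (f.map C) = f.map C + C f := by
    have h := hf ((C : R[X] →+* R[X][X]).comp C) X (C X)
    rw [taylor_apply, Polynomial.comp, eval₂_map, h, ← eval₂_map, eval₂_C_X, ← hom_eval₂,
      eval₂_C_X]
  have h := congrArg (coeff · j) htaylor
  simpa only [taylor_coeff, coeff_add, coeff_map, coeff_C, hj, if_false, add_zero,
    ← map_hasseDeriv, Polynomial.eval_map, eval₂_C_X] using h

lemma IsAdditive.exists_eq_pow {p : ℕ} (hp : p.Prime) (hR : (p : R) = 0) {f : R[X]}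
    (hf : IsAdditive f) {m : ℕ} (hm : f.coeff m ≠ 0) : ∃ i, m = p ^ i :=
  exists_eq_pow_of_hasseDeriv hp hR hf.coeff_zero (fun _ => hf.hasseDeriv_eq) hm

lemma IsAdditive.exists_natDegree_eq_pow {p : ℕ} (hp : p.Prime) (hR : (p : R) = 0) {f : R[X]}
    (hf : IsAdditive f) (hf0 : f ≠ 0) : ∃ i, f.natDegree = p ^ i :=
  hf.exists_eq_pow hp hR (leadingCoeff_ne_zero.2 hf0)

/-- The divisibility says that the zeros of `P` are stable under translation by the universal zero
of `P`, that is, that they form a subgroup. -/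
lemma isAdditive_of_dvd_taylor {p : ℕ} (hp : p.Prime) (hR : (p : R) = 0) {P : R[X]}
    (hP : P.Monic) (h0 : P.coeff 0 = 0)
    (h : P.map (AdjoinRoot.of P) ∣ taylor (AdjoinRoot.root P) (P.map (AdjoinRoot.of P))) :
    IsAdditive P := by
  refine .of_coeff hp hR fun m => exists_eq_pow_of_hasseDeriv hp hR h0 fun j hj => ?_
  rcases subsingleton_or_nontrivial R with _ | _
  · exact Subsingleton.elim _ _
  have htaylor := eq_of_monic_of_dvd_of_natDegree_le (hP.map (AdjoinRoot.of P))
    (show (taylor _ _).Monic by rw [Monic, leadingCoeff_taylor]; exact hP.map _) h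
    (natDegree_taylor _ _).le
  have hdvd : P ∣ hasseDeriv j P - C (P.coeff j) := by
    have hj := congrArg (coeff · j) htaylor
    simp only [taylor_coeff, coeff_map] at hj
    rwa [← map_hasseDeriv, Polynomial.eval_map, ← AdjoinRoot.algebraMap_eq, ← aeval_def,
      AdjoinRoot.aeval_eq, AdjoinRoot.algebraMap_eq, ← AdjoinRoot.mk_C, AdjoinRoot.mk_eq_mk] at hj
  have hdeg : P.natDegree ≠ 0 := fun hd => by simp [hP.natDegree_eq_zero.1 hd] at h0
  by_contra hne
  refine hP.not_dvd_of_natDegree_lt (sub_ne_zero.2 hne) ?_ hdvd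
  rw [natDegree_sub_C]
  exact (natDegree_hasseDeriv_le P j).trans_lt (by omega)

lemma exists_pow_eq_pow_pow {p f i : ℕ} (hp : 2 ≤ p) (h : p ^ f - 1 ∣ p ^ i - 1) :
    ∃ k, p ^ i = (p ^ f) ^ k := by
  have hgcd : p ^ f - 1 = p ^ f.gcd i - 1 := by
    rw [← Nat.pow_sub_one_gcd_pow_sub_one, Nat.gcd_eq_left h]
  have hpow : p ^ f = p ^ f.gcd i := by
    have := Nat.pow_pos (n := f) (show 0 < p by omega)
    have := Nat.pow_pos (n := f.gcd i) (show 0 < p by omega)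
    omega
  obtain ⟨k, rfl⟩ := Nat.gcd_eq_left_iff_dvd.1 (Nat.pow_right_injective hp hpow).symm
  exact ⟨k, pow_mul ..⟩

lemma IsAdditive.exists_eq_card_pow {Fq : Type*} [Field Fq] [Fintype Fq] (κ : Fq →+* R)
    {f : R[X]} (hf : IsAdditive f) (hlin : ∀ c, f.comp (C (κ c) * X) = C (κ c) * f)
    {m : ℕ} (hm : f.coeff m ≠ 0) : ∃ i, m = Fintype.card Fq ^ i := by
  obtain ⟨p, _⟩ := CharP.exists Fq
  obtain ⟨e, hp, hcard⟩ := FiniteField.card Fq p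
  have hR : (p : R) = 0 := by rw [← map_natCast κ, CharP.cast_eq_zero, map_zero]
  obtain ⟨i, rfl⟩ := hf.exists_eq_pow hp hR hm
  have hfix (c : Fqˣ) : (c : Fq) ^ p ^ i = c := by
    have h := congrArg (coeff · (p ^ i)) (hlin c)
    simp only [comp_C_mul_X_coeff, coeff_C_mul] at h
    by_contra hne
    have hunit : IsUnit (κ ((c : Fq) ^ p ^ i - c)) := (IsUnit.mk0 _ (sub_ne_zero.2 hne)).map κ
    refine hm (hunit.mul_right_eq_zero.1 ?_)
    rw [map_sub, map_pow, sub_mul, ← h, mul_comm, sub_self]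
  have hdvd : Fintype.card Fq - 1 ∣ p ^ i - 1 := by
    refine (FiniteField.forall_pow_eq_one_iff Fq _).1 fun c => mul_right_cancel (b := c) ?_
    rw [← pow_succ, Nat.sub_add_cancel (Nat.pow_pos hp.pos), one_mul]
    exact Units.ext (by simpa using hfix c)
  rw [hcard] at hdvd ⊢
  exact exists_pow_eq_pow_pow hp.two_le hdvd

lemma comp_C_mul_X_eq {P : R[X]} (hP : P.Monic) {c : R} {m : ℕ}
    (hdvd : P ∣ P.comp (C c * X)) (hreg : P.coeff m ∈ nonZeroDivisors R) (hc : c ^ m = c) :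
    P.comp (C c * X) = C c * P := by
  have hdeg : (P.comp (C c * X)).natDegree ≤ P.natDegree :=
    natDegree_comp_le.trans <|
      mul_le_of_le_one_right' ((natDegree_C_mul_le c X).trans natDegree_X_le)
  have heq := eq_mul_leadingCoeff_of_monic_of_dvd_of_natDegree_le hP hdvd hdeg
  have hlead : (P.comp (C c * X)).leadingCoeff = c := by
    have h := congrArg (coeff · m) heq
    simp only [comp_C_mul_X_coeff, coeff_mul_C, hc] at h
    exact ((mul_cancel_left_mem_nonZeroDivisors hreg).1 h).symm
  rw [heq, hlead, mul_comm]

lemma comp_right_injective {P : R[X]} (hP : P.Monic) (hd : P.natDegree ≠ 0) :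
    Function.Injective fun D : R[X] => D.comp P := fun D D' h => by
  have hsub : (D - D').comp P = 0 := by rw [sub_comp, sub_eq_zero]; exact h
  have hlead := coeff_comp_degree_mul_degree (p := D - D') hd
  rw [hsub, coeff_zero, hP.leadingCoeff, one_pow, mul_one] at hlead
  exact sub_eq_zero.1 (leadingCoeff_eq_zero.1 hlead.symm)

lemma IsAdditive.exists_degree_sub_lt {p : ℕ} (hp : p.Prime) (hR : (p : R) = 0) {P f : R[X]}
    (hP : P.Monic) (hPadd : IsAdditive P) (hf : IsAdditive f) (hf0 : f ≠ 0)
    (hle : P.natDegree ≤ f.natDegree) :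
    ∃ i, (f - C f.leadingCoeff * P ^ p ^ i).degree < f.degree := by
  have := Polynomial.nontrivial_iff.1 (nontrivial_of_ne f 0 hf0)
  obtain ⟨k, hk⟩ := hPadd.exists_natDegree_eq_pow hp hR hP.ne_zero
  obtain ⟨m, hm⟩ := hf.exists_natDegree_eq_pow hp hR hf0
  have hkm : k ≤ m := by rwa [hk, hm, Nat.pow_le_pow_iff_right hp.one_lt] at hle
  refine ⟨m - k, degree_sub_lt_left ?_ hf0 ?_⟩
  · rw [(hP.pow _).degree_mul, degree_C (leadingCoeff_ne_zero.2 hf0), zero_add,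
      degree_eq_natDegree (hP.pow _).ne_zero, degree_eq_natDegree hf0, hP.natDegree_pow, hk, hm,
      ← pow_add, Nat.sub_add_cancel hkm]
  · rw [leadingCoeff_mul_monic (hP.pow _), leadingCoeff_C]

lemma IsAdditive.exists_eq_comp {p : ℕ} (hp : p.Prime) (hR : (p : R) = 0) {P f : R[X]}
    (hP : P.Monic) (hPadd : IsAdditive P) (hf : IsAdditive f) (hdvd : P ∣ f) :
    ∃ D : R[X], IsAdditive D ∧ f = D.comp P := by
  induction hd : f.degree using WellFoundedLT.induction generalizing f with
  | _ d ih =>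
  rcases eq_or_ne f 0 with rfl | hf0
  · exact ⟨0, .zero, zero_comp.symm⟩
  have hle : P.natDegree ≤ f.natDegree := by
    by_contra! hlt
    exact hP.not_dvd_of_natDegree_lt hf0 hlt hdvd
  obtain ⟨i, hlt⟩ := hPadd.exists_degree_sub_lt hp hR hP hf hf0 hle
  have hpow : P ∣ C f.leadingCoeff * P ^ p ^ i :=
    (dvd_pow_self P (Nat.pow_pos hp.pos).ne').mul_left _
  obtain ⟨D, hD, hDf⟩ := ih _ (hd ▸ hlt) (hf.sub ((hPadd.pow_char_pow hp hR i).C_mul _))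
    (dvd_sub hdvd hpow) rfl
  refine ⟨D + C f.leadingCoeff * X ^ p ^ i,
    hD.add ((isAdditive_X.pow_char_pow hp hR i).C_mul _), ?_⟩
  rw [add_comp, ← hDf, mul_comp, C_comp, pow_comp, X_comp, sub_add_cancel]

lemma X_pow_dvd_of_coeff {f : R[X]} {q h : ℕ} (hq : 1 < q)
    (hf : ∀ {m}, f.coeff m ≠ 0 → ∃ i, m = q ^ i) (h0 : ∀ i < h, f.coeff (q ^ i) = 0) :
    X ^ q ^ h ∣ f := by
  rw [X_pow_dvd_iff]
  intro d hd
  by_contra hne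
  obtain ⟨i, rfl⟩ := hf hne
  exact hne (h0 i ((Nat.pow_lt_pow_iff_right hq).1 hd))

/-- Compare the coefficients of `X ^ m`: that of `Q ∘ φ` is `Q.coeff m * φ.coeff 1 ^ m`, and that
of `ψ ∘ Q` is `ψ.coeff 1 * Q.coeff m`. -/
lemma coeff_one_eq_pow_of_comp_eq {Q φ ψ : R[X]} {m : ℕ} (hQ : X ^ m ∣ Q) (hm : m ≠ 0)
    (hreg : Q.coeff m ∈ nonZeroDivisors R) (hφ : φ.coeff 0 = 0) (hψ : ψ.coeff 0 = 0)
    (h : Q.comp φ = ψ.comp Q) : ψ.coeff 1 = φ.coeff 1 ^ m := by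
  obtain ⟨Q, rfl⟩ := hQ
  obtain ⟨φ, rfl⟩ := X_dvd_iff.2 hφ
  obtain ⟨ψ, rfl⟩ := X_dvd_iff.2 hψ
  have hX (n : ℕ) (g : R[X]) : (X ^ n * g).coeff n = g.eval 0 := by
    rw [coeff_X_pow_mul', if_pos le_rfl, Nat.sub_self, coeff_zero_eq_eval_zero]
  have hX1 (g : R[X]) : (X * g).coeff 1 = g.eval 0 := by simpa using hX 1 g
  rw [hX] at hreg
  rw [hX1, hX1, ← mul_cancel_right_mem_nonZeroDivisors hreg]
  have hcoeff := congrArg (coeff · m) h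
  simp only [mul_comp, X_comp, pow_comp, mul_pow, mul_assoc, hX, eval_mul, eval_comp, eval_pow,
    eval_X, zero_mul, zero_pow hm] at hcoeff
  rw [hcoeff, mul_comm]

lemma associated_of_dvd_of_dvd {P Q : R[X]} (hP : P.Monic) (hPQ : P ∣ Q) (hQP : Q ∣ P) :
    Associated P Q := by
  obtain ⟨M, rfl⟩ := hPQ
  obtain ⟨N, hN⟩ := hQP
  have hMN : M * N = 1 := hP.isRegular.left <| by
    change P * (M * N) = P * 1
    rw [← mul_assoc, ← hN, mul_one]
  exact ⟨Units.mkOfMulEqOne M N hMN, rfl⟩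

lemma coeff_mem_nonZeroDivisors_of_associated {P Q : R[X]} {m : ℕ} (hPQ : Associated P Q)
    (hX : X ^ m ∣ P) (hreg : P.coeff m ∈ nonZeroDivisors R) : Q.coeff m ∈ nonZeroDivisors R := by
  obtain ⟨M, rfl⟩ := hPQ
  obtain ⟨P', rfl⟩ := hX
  have hunit : IsUnit ((M : R[X]).coeff 0) := M.isUnit.map constantCoeff
  have hcoeff (F : R[X]) : (X ^ m * F).coeff m = F.coeff 0 := by
    simpa only [zero_add] using coeff_X_pow_mul F m 0
  rw [hcoeff] at hreg
  rw [mul_assoc, hcoeff, mul_coeff_zero]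
  exact mul_mem hreg hunit.mem_nonZeroDivisors

end AdditivePolynomial

/-! ### The ring morphism defined by a polynomial -/

section AdjoinRoot

open Polynomial TensorProduct

lemma finrank_tensorProduct_adjoinRoot {A K : Type*} [CommRing A] [Field K] [Algebra A K]
    (F : A[X]) :
    Module.finrank K (K ⊗[A] AdjoinRoot F) = (F.map (algebraMap A K)).natDegree := by
  have hF : (F.map (Algebra.TensorProduct.includeRight (R := A) (A := K) (B := A)).toRingHom).map
      (Algebra.TensorProduct.rid A K K : K ⊗[A] A →+* K) = F.map (algebraMap A K) := by
    rw [Polynomial.map_map]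
    congr 1
    ext a
    simp [Algebra.smul_def]
  rw [((AdjoinRoot.tensorAlgEquiv F _ rfl).trans (AdjoinRoot.mapAlgEquiv
    (Algebra.TensorProduct.rid A K K) _ _ (Associated.of_eq hF))).toLinearEquiv.finrank_eq]
  exact finrank_quotient_span_eq_natDegree

lemma rankAtStalk_adjoinRoot {A : Type*} [CommRing A] (F : A[X]) [Module.Finite A (AdjoinRoot F)]
    [Module.Flat A (AdjoinRoot F)] (x : PrimeSpectrum A) :
    Module.rankAtStalk (AdjoinRoot F) x =
      (F.map (algebraMap A x.asIdeal.ResidueField)).natDegree := by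
  rw [Module.rankAtStalk_eq]
  exact finrank_tensorProduct_adjoinRoot F

end AdjoinRoot

namespace AdditivePolynomial

open Polynomial

variable {R : Type u} [CommRing R]

/-- The polynomial `D(X) - Y` in the variable `X` over `R[Y]`: the equation of the graph of the
map `c ↦ D(c)`. -/
noncomputable def graphPoly (D : R[X]) : R[X][X] := D.map C - C X

lemma graphPoly_monic {P : R[X]} (hP : P.Monic) (hd : P.natDegree ≠ 0) : (graphPoly P).Monic := by
  rcases subsingleton_or_nontrivial R with _ | _
  · exact Subsingleton.elim _ _
  refine (hP.map C).sub_of_left (degree_C_le.trans_lt ?_)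
  rw [← natDegree_pos_iff_degree_pos, hP.natDegree_map]
  exact Nat.pos_of_ne_zero hd

lemma eval₂_graphPoly {B : Type*} [CommRing B] (f : R[X] →+* B) (b : B) (D : R[X]) :
    (graphPoly D).eval₂ f b = D.eval₂ (f.comp C) b - f X := by
  rw [graphPoly, eval₂_sub, eval₂_map, eval₂_C]

/-- The projection of the graph of `c ↦ D(c)` onto the source of that map, as an isomorphism of
rings. The structure morphism of `R[Y][X] / (D(X) - Y)` over `R[Y]` then becomes
`compRingHom D`. -/
noncomputable def graphEquiv (D : R[X]) : AdjoinRoot (graphPoly D) ≃+* R[X] :=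
  RingEquiv.ofRingHom
    (AdjoinRoot.lift (compRingHom D) X (by
      have hC : (compRingHom D).comp C = C := by ext; simp
      rw [eval₂_graphPoly, hC, eval₂_C_X, coe_compRingHom_apply, X_comp, sub_self]))
    (eval₂RingHom ((AdjoinRoot.of (graphPoly D)).comp C) (AdjoinRoot.root (graphPoly D)))
    (by ext <;> simp)
    (by
      have h := AdjoinRoot.eval₂_root (graphPoly D)
      rw [eval₂_graphPoly, sub_eq_zero] at h
      ext <;> simp [h])

lemma graphEquiv_comp_algebraMap (D : R[X]) :
    (graphEquiv D : AdjoinRoot (graphPoly D) →+* R[X]).comp (algebraMap _ _) =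
      compRingHom D := by
  ext <;> simp [graphEquiv, AdjoinRoot.algebraMap_eq]

lemma graphEquiv_symm_comp_compRingHom (D : R[X]) :
    ((graphEquiv D).symm : R[X] →+* AdjoinRoot (graphPoly D)).comp (compRingHom D) =
      algebraMap R[X] (AdjoinRoot (graphPoly D)) := by
  rw [← graphEquiv_comp_algebraMap, ← RingHom.comp_assoc, RingEquiv.symm_comp, RingHom.id_comp]

lemma finite_compRingHom {P : R[X]} (hP : P.Monic) (hd : P.natDegree ≠ 0) :
    (compRingHom P).Finite := by
  have := (graphPoly_monic hP hd).finite_adjoinRoot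
  rw [← graphEquiv_comp_algebraMap]
  exact .comp (.of_surjective _ (graphEquiv P).surjective) (RingHom.finite_algebraMap.2 this)

lemma flat_compRingHom {P : R[X]} (hP : P.Monic) (hd : P.natDegree ≠ 0) :
    (compRingHom P).Flat := by
  have := (graphPoly_monic hP hd).free_adjoinRoot
  rw [← graphEquiv_comp_algebraMap]
  exact .comp (RingHom.flat_algebraMap_iff.2 inferInstance) (.of_bijective (graphEquiv P).bijective)

lemma finrank_compRingHom {D : R[X]} (hfin : (compRingHom D).Finite)
    (hflat : (compRingHom D).Flat) (x : PrimeSpectrum R[X]) :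
    (compRingHom D).finrank x =
      (D.map ((algebraMap R[X] x.asIdeal.ResidueField).comp C)).natDegree := by
  have hfin' : (algebraMap R[X] (AdjoinRoot (graphPoly D))).Finite := by
    rw [← graphEquiv_symm_comp_compRingHom]
    exact .comp (.of_surjective _ (graphEquiv D).symm.surjective) hfin
  have hflat' : (algebraMap R[X] (AdjoinRoot (graphPoly D))).Flat := by
    rw [← graphEquiv_symm_comp_compRingHom]
    exact hflat.comp (.of_bijective (graphEquiv D).symm.bijective)
  have := RingHom.finite_algebraMap.1 hfin'
  have := RingHom.flat_algebraMap_iff.1 hflat'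
  have hrank := RingHom.finrank_comp_left_of_bijective _
    (graphEquiv D : AdjoinRoot (graphPoly D) →+* R[X]) (graphEquiv D).bijective hfin' hflat' x
  rw [← graphEquiv_comp_algebraMap, hrank, RingHom.finrank_algebraMap, rankAtStalk_adjoinRoot,
    graphPoly, Polynomial.map_sub, map_C, natDegree_sub_C, Polynomial.map_map]

lemma exists_retraction_compRingHom {P : R[X]} (hP : P.Monic) (hd : P.natDegree ≠ 0) :
    ∃ ρ : R[X] →+ R[X], ρ 1 = 1 ∧ ∀ a b, ρ (compRingHom P a * b) = a * ρ b := by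
  rcases subsingleton_or_nontrivial R with _ | _
  · exact ⟨0, Subsingleton.elim _ _, fun _ _ => Subsingleton.elim _ _⟩
  have hpos : 0 < (graphPoly P).natDegree := by
    rw [graphPoly, natDegree_sub_C, hP.natDegree_map]
    exact Nat.pos_of_ne_zero hd
  let b := (AdjoinRoot.isAdjoinRootMonic _ (graphPoly_monic hP hd)).basis
  have hb : b ⟨0, hpos⟩ = 1 := by simp [b, IsAdjoinRootMonic.basis_apply]
  refine ⟨(b.coord ⟨0, hpos⟩).toAddMonoidHom.comp (graphEquiv P).symm.toAddMonoidHom, ?_,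
    fun a c => ?_⟩
  · change b.coord ⟨0, hpos⟩ ((graphEquiv P).symm 1) = 1
    rw [map_one, ← hb]
    simp
  · change b.coord ⟨0, hpos⟩ ((graphEquiv P).symm (compRingHom P a * c)) = _
    have ha : (graphEquiv P).symm (compRingHom P a) = algebraMap _ _ a :=
      RingHom.congr_fun (graphEquiv_symm_comp_compRingHom P) a
    rw [map_mul, ha, ← Algebra.smul_def, map_smul, smul_eq_mul]
    rfl

end AdditivePolynomial

lemma finite_and_flat_of_retraction {A B C : Type*} [CommRing A] [CommRing B] [CommRing C]
    (f : A →+* B) (g : B →+* C) (hfin : (g.comp f).Finite) (hflat : (g.comp f).Flat)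
    (ρ : C →+ B) (h1 : ρ 1 = 1) (hρ : ∀ b c, ρ (g b * c) = b * ρ c) : f.Finite ∧ f.Flat := by
  algebraize [f, g, g.comp f]
  let ρ' : C →ₗ[A] B := { ρ with
    map_smul' := fun a c => by
      simp only [Algebra.smul_def]
      exact hρ _ _ }
  let i : B →ₗ[A] C := (IsScalarTower.toAlgHom A B C).toLinearMap
  have hi : ρ' ∘ₗ i = LinearMap.id := by
    ext b
    change ρ (g b) = b
    simpa only [mul_one, h1] using hρ b 1
  exact ⟨Module.Finite.of_surjective ρ' fun b => ⟨i b, LinearMap.congr_fun hi b⟩,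
    Module.Flat.of_retract i ρ' hi⟩

namespace AdditivePolynomial

open Polynomial

variable {R : Type u} [CommRing R]

lemma compRingHom_comp (D P : R[X]) :
    compRingHom (D.comp P) = (compRingHom P).comp (compRingHom D) := by
  ext <;> simp

lemma finite_and_flat_compRingHom_of_comp_eq {P φ D : R[X]} (hP : P.Monic) (hd : P.natDegree ≠ 0)
    (hfin : (compRingHom φ).Finite) (hflat : (compRingHom φ).Flat)
    (h : P.comp φ = D.comp P) : (compRingHom D).Finite ∧ (compRingHom D).Flat := by
  obtain ⟨ρ, h1, hρ⟩ := exists_retraction_compRingHom hP hd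
  have hcomp : (compRingHom P).comp (compRingHom D) = (compRingHom φ).comp (compRingHom P) := by
    rw [← compRingHom_comp, ← h, compRingHom_comp]
  refine finite_and_flat_of_retraction (compRingHom D) (compRingHom P) ?_ ?_ ρ h1 hρ
  · rw [hcomp]
    exact hfin.comp (finite_compRingHom hP hd)
  · rw [hcomp]
    exact (flat_compRingHom hP hd).comp hflat

lemma natDegree_map_eq_of_comp_eq {P φ D : R[X]} (hP : P.Monic) (hd : P.natDegree ≠ 0)
    (h : P.comp φ = D.comp P) {K : Type*} [CommRing K] [IsDomain K] (f : R →+* K) :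
    (D.map f).natDegree = (φ.map f).natDegree := by
  have hdegree := congrArg (fun Q => (Q.map f).natDegree) h
  simp only [Polynomial.map_comp, natDegree_comp, hP.natDegree_map, mul_comm P.natDegree]
    at hdegree
  exact (Nat.eq_of_mul_eq_mul_right (Nat.pos_of_ne_zero hd) hdegree).symm

end AdditivePolynomial

/-! ### Finite flat closed subschemes of the affine line -/

section FiniteFlat

open Polynomial TensorProduct

lemma exists_monic_forall_aeval_eq_zero_iff {R B : Type*} [CommRing R] [CommRing B] [Algebra R B]
    [Module.Free R B] [Module.Finite R B] (x : B)
    (hx : Function.Surjective (aeval x : R[X] →ₐ[R] B)) :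
    ∃ P : R[X], P.Monic ∧ ∀ f : R[X], aeval x f = 0 ↔ P ∣ f := by
  rcases subsingleton_or_nontrivial R with _ | _
  · have : Subsingleton B := Module.subsingleton R B
    exact ⟨0, Subsingleton.elim _ _, fun f =>
      ⟨fun _ => by rw [Subsingleton.elim f 0], fun _ => Subsingleton.elim _ _⟩⟩
  set P := (Algebra.lmul R B x).charpoly with hPdef
  have hP : P.Monic := LinearMap.charpoly_monic _
  have hPx : aeval x P = 0 := by
    have hcayley := LinearMap.aeval_self_charpoly (Algebra.lmul R B x)
    rw [aeval_algHom_apply] at hcayley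
    simpa [P] using LinearMap.congr_fun hcayley 1
  refine ⟨P, hP, fun f => ⟨fun hf => ?_, ?_⟩⟩
  · let φ : AdjoinRoot P →ₐ[R] B := AdjoinRoot.liftAlgHom P (Algebra.ofId R B) x hPx
    have hsurj : Function.Surjective φ := fun b => by
      obtain ⟨g, rfl⟩ := hx b
      exact ⟨AdjoinRoot.mk P g, AdjoinRoot.liftAlgHom_mk _ _ _ _ _⟩
    have := hP.finite_adjoinRoot
    have := hP.free_adjoinRoot
    have hbij := OrzechProperty.bijective_of_surjective_of_finrank_le φ.toLinearMap hsurj (by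
      rw [(AdjoinRoot.isAdjoinRootMonic P hP).finrank, hPdef, LinearMap.charpoly_natDegree])
    rw [← AdjoinRoot.mk_eq_zero]
    refine hbij.1 (Eq.trans ?_ (map_zero φ).symm)
    exact (AdjoinRoot.liftAlgHom_mk P _ x hPx f).trans hf
  · rintro ⟨g, rfl⟩
    rw [map_mul, hPx, zero_mul]

section BaseChange

variable {R Q L : Type*} [CommRing R] [CommRing L] [Algebra R L] [CommRing Q] [Algebra R Q]
  {q : R[X] →ₐ[R] Q}

lemma aeval_one_tmul_map (f : R[X]) :
    aeval ((1 : L) ⊗ₜ[R] q X) (f.map (algebraMap R L)) = (1 : L) ⊗ₜ[R] q f := by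
  have hX : (1 : L) ⊗ₜ[R] q X =
    ((Algebra.TensorProduct.includeRight : Q →ₐ[R] L ⊗[R] Q).comp q) X := rfl
  rw [aeval_map_algebraMap, hX, aeval_algHom_apply, aeval_X_left_apply]
  rfl

lemma aeval_one_tmul_surjective (hq : Function.Surjective q) :
    Function.Surjective (aeval (R := L) ((1 : L) ⊗ₜ[R] q X)) := by
  intro b
  induction b using TensorProduct.induction_on with
  | zero => exact ⟨0, map_zero _⟩
  | tmul a b =>
    obtain ⟨f, rfl⟩ := hq b
    exact ⟨a • f.map (algebraMap R L), by
      rw [map_smul, aeval_one_tmul_map, TensorProduct.smul_tmul', smul_eq_mul, mul_one]⟩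
  | add a b ha hb =>
    obtain ⟨f, rfl⟩ := ha
    obtain ⟨g, rfl⟩ := hb
    exact ⟨f + g, map_add _ _ _⟩

lemma eval₂_eq_zero_of_aeval_one_tmul (hq : Function.Surjective q) {P : L[X]}
    (hP : aeval ((1 : L) ⊗ₜ[R] q X) P = 0) {R' : Type*} [CommRing R']
    (θ : L →+* R') (c : R') (h : ∀ f, q f = 0 → f.eval₂ (θ.comp (algebraMap R L)) c = 0) :
    P.eval₂ θ c = 0 := by
  algebraize [θ, θ.comp (algebraMap R L)]
  let F₀ : Q →ₐ[R] R' := AlgHom.liftOfSurjective q hq (aeval c) h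
  let F : L ⊗[R] Q →ₐ[L] R' := Algebra.TensorProduct.lift (Algebra.ofId L R') F₀
    (fun _ _ => Commute.all _ _)
  have hF : F (1 ⊗ₜ q X) = c := by
    refine (Algebra.TensorProduct.lift_tmul ..).trans ?_
    rw [map_one, one_mul]
    exact (AlgHom.liftOfSurjective_apply q hq (aeval c) h X).trans (aeval_X c)
  have hFP := congrArg F hP
  rwa [← aeval_algHom_apply, hF, map_zero] at hFP

lemma exists_monic_of_free_tensorProduct [Module.Finite R Q] [Module.Free L (L ⊗[R] Q)]
    (hq : Function.Surjective q) :
    ∃ P : L[X], P.Monic ∧ ∀ ⦃R' : Type u⦄ [CommRing R'] (θ : L →+* R') (c : R'),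
      (∀ f, q f = 0 → f.eval₂ (θ.comp (algebraMap R L)) c = 0) ↔ P.eval₂ θ c = 0 := by
  obtain ⟨P, hP, hPdvd⟩ :=
    exists_monic_forall_aeval_eq_zero_iff _ (aeval_one_tmul_surjective (L := L) hq)
  refine ⟨P, hP, fun R' _ θ c =>
    ⟨eval₂_eq_zero_of_aeval_one_tmul hq ((hPdvd P).2 dvd_rfl) θ c, fun h f hf => ?_⟩⟩
  rw [← eval₂_map]
  refine eval₂_eq_zero_of_dvd_of_eval₂_eq_zero _ _ ((hPdvd _).1 ?_) h
  rw [aeval_one_tmul_map, hf, TensorProduct.tmul_zero]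

end BaseChange

lemma exists_monic_of_flat {R Q : Type u} [CommRing R] [IsNoetherianRing R] [CommRing Q]
    [Algebra R Q] [Module.Finite R Q] [Module.Flat R Q] {q : R[X] →ₐ[R] Q}
    (hq : Function.Surjective q) (p : PrimeSpectrum R) :
    ∃ r ∉ p.asIdeal, ∀ ⦃R' : Type u⦄ [CommRing R'] (ψ : R →+* R'), IsUnit (ψ r) →
      ∃ P : R'[X], P.Monic ∧ ∀ ⦃R'' : Type u⦄ [CommRing R''] (θ : R' →+* R'') (c : R''),
        (∀ f, q f = 0 → f.eval₂ (θ.comp ψ) c = 0) ↔ P.eval₂ θ c = 0 := by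
  have : Module.FinitePresentation R Q := Module.finitePresentation_of_finite _ _
  have hfree : p ∈ Module.freeLocus R Q := by
    rw [Module.freeLocus_eq_univ]
    exact Set.mem_univ p
  rw [Module.mem_freeLocus] at hfree
  obtain ⟨r, hr, hfree_r, -⟩ := Module.FinitePresentation.exists_free_localizedModule_powers
    p.asIdeal.primeCompl (LocalizedModule.mkLinearMap p.asIdeal.primeCompl Q)
    (Localization.AtPrime p.asIdeal)
  have : Module.Free (Localization.Away r) (Localization.Away r ⊗[R] Q) :=
    Module.Free.of_equiv (LocalizedModule.equivTensorProduct (Submonoid.powers r) Q)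
  obtain ⟨P, hP, hPzero⟩ := exists_monic_of_free_tensorProduct (L := Localization.Away r) hq
  refine ⟨r, hr, fun R' _ ψ hψ => ?_⟩
  refine ⟨P.map (IsLocalization.Away.lift r hψ), hP.map _, fun R'' _ θ c => ?_⟩
  rw [eval₂_map, ← hPzero, RingHom.comp_assoc, IsLocalization.Away.lift_comp]

end FiniteFlat

/-! ### Affine schemes over an affine `S`-scheme -/

section SpecOver

open Polynomial

lemma isoSpec_inv_appTop (X : Scheme.{u}) [IsAffine X] :
    X.isoSpec.inv.appTop = (Scheme.ΓSpecIso Γ(X, ⊤)).inv := by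
  rw [← Category.id_comp (Scheme.ΓSpecIso _).inv, Iso.eq_comp_inv, ← Scheme.toSpecΓ_appTop,
    ← Scheme.isoSpec_hom, ← Scheme.Hom.comp_appTop, Iso.hom_inv_id, Scheme.Hom.id_appTop]

lemma exists_hom_appTop_eq {X Y : Scheme.{u}} [IsAffine X] (ψ : Γ(X, ⊤) →+* Γ(Y, ⊤)) :
    ∃ f : Y ⟶ X, f.appTop.hom = ψ := by
  refine ⟨Y.toSpecΓ ≫ Spec.map (CommRingCat.ofHom ψ) ≫ X.isoSpec.inv, ?_⟩
  have happ : (Y.toSpecΓ ≫ Spec.map (CommRingCat.ofHom ψ) ≫ X.isoSpec.inv).appTop =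
      CommRingCat.ofHom ψ := by
    rw [Scheme.Hom.comp_appTop, Scheme.Hom.comp_appTop, isoSpec_inv_appTop, Category.assoc,
      ← Scheme.ΓSpecIso_inv_naturality_assoc, Scheme.toSpecΓ_appTop, Iso.inv_hom_id,
      Category.comp_id]
  exact congrArg CommRingCat.Hom.hom happ

variable {S : Scheme.{u}}

/-- The `S`-scheme `Spec R'`, for an algebra `R'` over the functions on an affine `S`-scheme `T`.
The points of line bundles in such schemes are what determines polynomials over `T`. -/
noncomputable def specOver (T : Over S) [IsAffine T.left] {R' : Type u} [CommRing R']
    (φ : Γ(T.left, ⊤) →+* R') : Over S :=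
  Over.mk (Spec.map (CommRingCat.ofHom φ) ≫ T.left.isoSpec.inv ≫ T.hom)

section

variable (T : Over S) [IsAffine T.left] {R' : Type u} [CommRing R'] (φ : Γ(T.left, ⊤) →+* R')

/-- The structure morphism of `specOver T φ` over `T`. -/
noncomputable def specOverProj : specOver T φ ⟶ T :=
  Over.homMk (Spec.map (CommRingCat.ofHom φ) ≫ T.left.isoSpec.inv) (by simp [specOver])

/-- The identification of `R'` with the functions on `Spec R'`. -/
noncomputable def specOverEquiv : R' ≃+* Γ((specOver T φ).left, ⊤) :=
  (Scheme.ΓSpecIso (CommRingCat.of R')).commRingCatIsoToRingEquiv.symm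

instance : IsAffine (specOver T φ).left :=
  inferInstanceAs (IsAffine (Spec (CommRingCat.of R')))

lemma specOverProj_appTop :
    (specOverProj T φ).left.appTop.hom = (specOverEquiv T φ : R' →+* _).comp φ := by
  have happ : (Spec.map (CommRingCat.ofHom φ) ≫ T.left.isoSpec.inv).appTop =
      CommRingCat.ofHom φ ≫ (Scheme.ΓSpecIso (CommRingCat.of R')).inv := by
    rw [Scheme.Hom.comp_appTop, isoSpec_inv_appTop]
    exact (Scheme.ΓSpecIso_inv_naturality (CommRingCat.ofHom φ)).symm
  exact congrArg CommRingCat.Hom.hom happ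

lemma eval₂_specOverProj (F : Γ(T.left, ⊤)[X]) (x : R') :
    F.eval₂ (specOverProj T φ).left.appTop.hom (specOverEquiv T φ x) =
      specOverEquiv T φ (F.eval₂ φ x) := by
  rw [specOverProj_appTop]
  exact (hom_eval₂ F φ (specOverEquiv T φ).toRingHom x).symm

variable {T φ}

lemma specOver_hom_ext {Y : Over S} {k k' : Y ⟶ specOver T φ}
    (h : ∀ x, k.left.appTop.hom (specOverEquiv T φ x) =
      k'.left.appTop.hom (specOverEquiv T φ x)) : k = k' := by
  refine Over.OverMorphism.ext (ext_of_isAffine ?_)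
  ext x
  obtain ⟨y, rfl⟩ := (specOverEquiv T φ).surjective x
  exact h y

lemma exists_hom_specOver {Y : Over S} (h : Y ⟶ T) (ψ : R' →+* Γ(Y.left, ⊤))
    (hψ : ψ.comp φ = h.left.appTop.hom) :
    ∃ k : Y ⟶ specOver T φ, k ≫ specOverProj T φ = h ∧
      ∀ x, k.left.appTop.hom (specOverEquiv T φ x) = ψ x := by
  obtain ⟨k, hk⟩ := exists_hom_appTop_eq (X := (specOver T φ).left)
    (ψ.comp (specOverEquiv T φ).symm.toRingHom)
  have hkψ (x : R') : k.appTop.hom (specOverEquiv T φ x) = ψ x := by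
    rw [hk]
    exact congrArg ψ ((specOverEquiv T φ).symm_apply_apply x)
  have hkh : k ≫ (specOverProj T φ).left = h.left := by
    refine ext_of_isAffine (CommRingCat.hom_ext (RingHom.ext fun x => ?_))
    rw [← hψ, Scheme.Hom.comp_appTop, CommRingCat.hom_comp, specOverProj_appTop]
    exact hkψ (φ x)
  refine ⟨Over.homMk k ?_, Over.OverMorphism.ext hkh, hkψ⟩
  rw [← Over.w (specOverProj T φ), ← Category.assoc, hkh, Over.w h]

end

variable {T : Over S} [IsAffine T.left]

lemma eq_of_forall_eval₂ {P Q : Γ(T.left, ⊤)[X]}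
    (h : ∀ (T' : Over S) (g : T' ⟶ T) (c : Γ(T'.left, ⊤)),
      P.eval₂ g.left.appTop.hom c = Q.eval₂ g.left.appTop.hom c) : P = Q := by
  have hX := h _ (specOverProj T C) (specOverEquiv T C X)
  simpa only [eval₂_specOverProj, eval₂_C_X, EmbeddingLike.apply_eq_iff_eq] using hX

lemma dvd_of_forall_eval₂_of_hom {R' : Type u} [CommRing R'] (φ : Γ(T.left, ⊤) →+* R')
    {P Q : R'[X]}
    (h : ∀ (T' : Over S) (g : T' ⟶ T) (ψ : R' →+* Γ(T'.left, ⊤)),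
      ψ.comp φ = g.left.appTop.hom → ∀ c, P.eval₂ ψ c = 0 → Q.eval₂ ψ c = 0) : P ∣ Q := by
  have heval (F : R'[X]) := hom_eval₂ F (AdjoinRoot.of P)
    (specOverEquiv T ((AdjoinRoot.of P).comp φ)).toRingHom (AdjoinRoot.root P)
  have hroot := h _ (specOverProj T _)
    ((specOverEquiv T ((AdjoinRoot.of P).comp φ)).toRingHom.comp (AdjoinRoot.of P))
    (by rw [specOverProj_appTop, RingHom.comp_assoc]; rfl) _
    ((heval P).symm.trans (by rw [AdjoinRoot.eval₂_root, map_zero]))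
  rw [← AdjoinRoot.mk_eq_zero, ← AdjoinRoot.aeval_eq, aeval_def, AdjoinRoot.algebraMap_eq]
  exact (map_eq_zero_iff _ (specOverEquiv T _).injective).mp ((heval Q).trans hroot)

lemma dvd_of_forall_eval₂ {P Q : Γ(T.left, ⊤)[X]}
    (h : ∀ (T' : Over S) (g : T' ⟶ T) (c : Γ(T'.left, ⊤)),
      P.eval₂ g.left.appTop.hom c = 0 → Q.eval₂ g.left.appTop.hom c = 0) : P ∣ Q :=
  dvd_of_forall_eval₂_of_hom (RingHom.id _) fun T' g ψ hψ => by
    rw [RingHom.comp_id] at hψ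
    exact hψ ▸ h T' g

end SpecOver

/-! ### Bases of line bundles and local expressions -/

namespace LineBundle

open Polynomial

variable {S : Scheme.{u}} {V W W' : LineBundle S} {T T' : Over S}

/-- The section `b` over `T` is a basis of the restriction of the line bundle to `T`. This extends
frames, which live over opens of `S`, to arbitrary `S`-schemes. -/
def IsBasis (b : T ⟶ V.total) : Prop :=
  ∀ (T' : Over S) (g : T' ⟶ T), Function.Bijective fun c : Γ(T'.left, ⊤) => c • (g ≫ b)

namespace IsBasis

variable {b b' : T ⟶ V.total}

lemma comp (hb : IsBasis b) (g : T' ⟶ T) : IsBasis (g ≫ b) := fun T'' g' => by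
  simpa only [Category.assoc] using hb T'' (g' ≫ g)

lemma smul_injective (hb : IsBasis b) (g : T' ⟶ T) {c d : Γ(T'.left, ⊤)}
    (h : c • (g ≫ b) = d • (g ≫ b)) : c = d :=
  (hb T' g).1 h

lemma smul_eq_zero_iff (hb : IsBasis b) (g : T' ⟶ T) {c : Γ(T'.left, ⊤)} :
    c • (g ≫ b) = 0 ↔ c = 0 :=
  ⟨fun h => hb.smul_injective g (by rw [h, zero_smul]), fun h => by rw [h, zero_smul]⟩

lemma exists_smul (hb : IsBasis b) (g : T' ⟶ T) (x : T' ⟶ V.total) :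
    ∃ c : Γ(T'.left, ⊤), x = c • (g ≫ b) :=
  ((hb T' g).2 x).imp fun _ => Eq.symm

lemma exists_unit (hb : IsBasis b) (hb' : IsBasis b') :
    ∃ u : Γ(T.left, ⊤)ˣ, b = (u : Γ(T.left, ⊤)) • b' := by
  obtain ⟨u, hu⟩ := hb'.exists_smul (𝟙 T) b
  obtain ⟨v, hv⟩ := hb.exists_smul (𝟙 T) b'
  rw [Category.id_comp] at hu hv
  have huv : u * v = 1 := hb'.smul_injective (𝟙 T) (by
    rw [Category.id_comp, one_smul, mul_comm, mul_smul, ← hu, ← hv])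
  exact ⟨⟨u, v, huv, by rw [mul_comm, huv]⟩, hu⟩

end IsBasis

/-- With respect to the sections `b`, `b'` over `T`, the morphism `f` is the polynomial map
`c ↦ P(c)`. For frames over an open of `S` this is `IsLocalExpr`. -/
def LocalExpr (f : V.total ⟶ W.total) (b : T ⟶ V.total) (b' : T ⟶ W.total)
    (P : Γ(T.left, ⊤)[X]) : Prop :=
  ∀ (T' : Over S) (g : T' ⟶ T) (c : Γ(T'.left, ⊤)),
    (c • (g ≫ b)) ≫ f = P.eval₂ g.left.appTop.hom c • (g ≫ b')

namespace LocalExpr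

variable {f : V.total ⟶ W.total} {b : T ⟶ V.total} {b' : T ⟶ W.total} {P : Γ(T.left, ⊤)[X]}

lemma restrict (h : LocalExpr f b b' P) (g : T' ⟶ T) :
    LocalExpr f (g ≫ b) (g ≫ b') (P.map g.left.appTop.hom) := fun T'' g' c => by
  rw [eval₂_map, ← Category.assoc, h T'' (g' ≫ g) c, Over.comp_left, Scheme.Hom.comp_appTop,
    CommRingCat.hom_comp, Category.assoc]

lemma comp {f' : W.total ⟶ W'.total} {b'' : T ⟶ W'.total} {Q : Γ(T.left, ⊤)[X]}
    (h : LocalExpr f b b' P) (h' : LocalExpr f' b' b'' Q) :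
    LocalExpr (f ≫ f') b b'' (Q.comp P) := fun T' g c => by
  rw [← Category.assoc, h T' g c, h' T' g, eval₂_comp]

lemma smul (h : LocalExpr f b b' P) (u : Γ(T.left, ⊤)) :
    LocalExpr f (u • b) b' (P.comp (C u * X)) := fun T' g c => by
  rw [comp_smul, smul_smul, h T' g, eval₂_comp, eval₂_mul, eval₂_C, eval₂_X, mul_comm]

lemma mul_left {u : Γ(T.left, ⊤)} (h : LocalExpr f b (u • b') P) :
    LocalExpr f b b' (C u * P) := fun T' g c => by
  rw [h T' g, comp_smul, smul_smul, eval₂_mul, eval₂_C, mul_comm]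

lemma unique [IsAffine T.left] (hb' : IsBasis b') {Q : Γ(T.left, ⊤)[X]}
    (hP : LocalExpr f b b' P) (hQ : LocalExpr f b b' Q) : P = Q :=
  eq_of_forall_eval₂ fun T' g c => hb'.smul_injective g (by rw [← hP T' g c, ← hQ T' g c])

end LocalExpr

/-- Evaluate `f` at the universal point of the affine line over `T`. -/
lemma exists_localExpr [IsAffine T.left] (f : V.total ⟶ W.total) (b : T ⟶ V.total)
    {b' : T ⟶ W.total} (hb' : IsBasis b') : ∃ P : Γ(T.left, ⊤)[X], LocalExpr f b b' P := by
  obtain ⟨c, hc⟩ := hb'.exists_smul (specOverProj T C)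
    ((specOverEquiv T C X • (specOverProj T C ≫ b)) ≫ f)
  obtain ⟨P, rfl⟩ := (specOverEquiv T C).surjective c
  refine ⟨P, fun T' g c => ?_⟩
  obtain ⟨k, hkg, hk⟩ := exists_hom_specOver (φ := C) g (eval₂RingHom g.left.appTop.hom c)
    (RingHom.ext fun _ => eval₂_C _ _)
  have hcomp := congrArg (k ≫ ·) hc
  simpa only [comp_smul, ← Category.assoc, hkg, hk, coe_eval₂RingHom, eval₂_X] using hcomp

end LineBundle

/-! ### Gluing over open covers of the base -/

section Gluing

open TopologicalSpace

variable {S : Scheme.{u}}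

lemma isOpenCover_of_forall_mem {X : Type*} [TopologicalSpace X] {U : X → Opens X}
    (hU : ∀ x, x ∈ U x) : IsOpenCover U :=
  IsOpenCover.mk (eq_top_iff.2 fun x _ => Opens.mem_iSup.2 ⟨x, hU x⟩)

/-- The open subscheme `U` of `S` as an `S`-scheme. -/
noncomputable abbrev opensOver (U : S.Opens) : Over S := Over.mk U.ι

section Restrict

variable {T Z : Over S} {U : S.Opens}

lemma opensOver_hom_subsingleton (g g' : T ⟶ opensOver U) : g = g' := by
  apply Over.OverMorphism.ext
  rw [← cancel_mono U.ι]
  exact (Over.w g).trans (Over.w g').symm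

lemma nonempty_hom_opensOver (h : ∀ x, T.hom x ∈ U) : Nonempty (T ⟶ opensOver U) := by
  have hrange : Set.range T.hom ⊆ Set.range U.ι := by
    rintro _ ⟨x, rfl⟩
    simpa using h x
  exact ⟨Over.homMk (IsOpenImmersion.lift U.ι T.hom hrange) (IsOpenImmersion.lift_fac _ _ _)⟩

lemma hom_apply_mem_of_hom_opensOver (g : T ⟶ opensOver U) (x : T.left) : T.hom x ∈ U := by
  rw [← Over.w g]
  exact (g.left x).2

variable (T U)

/-- The restriction of the `S`-scheme `T` to the open subset `U` of `S`. -/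
noncomputable def restrictOver : Over S :=
  Over.mk ((T.hom ⁻¹ᵁ U).ι ≫ T.hom)

/-- The inclusion of the part of `T` over `U` in `T`. -/
noncomputable def restrictIncl : restrictOver T U ⟶ T :=
  Over.homMk (T.hom ⁻¹ᵁ U).ι rfl

instance : IsOpenImmersion (restrictIncl T U).left :=
  inferInstanceAs (IsOpenImmersion (T.hom ⁻¹ᵁ U).ι)

/-- The structure morphism of the part of `T` over `U`, as a morphism to `U`. -/
noncomputable def restrictProj : restrictOver T U ⟶ opensOver U :=
  Over.homMk (T.hom ∣_ U) (morphismRestrict_ι _ _)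

variable {T U}

lemma exists_hom_restrictOver (z : T ⟶ Z) (g : T ⟶ opensOver U) :
    ∃ k : T ⟶ restrictOver Z U, k ≫ restrictIncl Z U = z := by
  have hrange : Set.range z.left ⊆ Set.range (restrictIncl Z U).left := by
    rintro _ ⟨x, rfl⟩
    refine ⟨⟨z.left x, ?_⟩, rfl⟩
    change Z.hom (z.left x) ∈ U
    rw [← Scheme.Hom.comp_apply, Over.w z]
    exact hom_apply_mem_of_hom_opensOver g x
  have hlift := IsOpenImmersion.lift_fac (restrictIncl Z U).left z.left hrange
  refine ⟨Over.homMk (IsOpenImmersion.lift _ z.left hrange) ?_, Over.OverMorphism.ext hlift⟩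
  change _ ≫ (restrictIncl Z U).left ≫ Z.hom = _
  rw [← Category.assoc, hlift, Over.w z]

end Restrict

lemma over_hom_ext_of_isAffine {T Z : Over S} {x y : T ⟶ Z}
    (h : ∀ (T' : Over S) (g : T' ⟶ T), IsAffine T'.left → g ≫ x = g ≫ y) : x = y := by
  refine Over.OverMorphism.ext (T.left.affineCover.hom_ext _ _ fun i => ?_)
  exact congrArg (fun k => k.left) (h (Over.mk (T.left.affineCover.f i ≫ T.hom))
    (Over.homMk (T.left.affineCover.f i) rfl)
    (inferInstanceAs (IsAffine (T.left.affineCover.X i))))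

section Cover

variable {ι : Type u} {U : ι → S.Opens}

/-- The open cover of an `S`-scheme induced by an open cover of `S`. -/
noncomputable def restrictCover (hU : IsOpenCover U) (T : Over S) : T.left.OpenCover :=
  T.left.openCoverOfIsOpenCover (fun i => T.hom ⁻¹ᵁ U i)
    (hU.comap ⟨T.hom, T.hom.continuous⟩)

lemma over_hom_ext (hU : IsOpenCover U) {T Z : Over S} {x y : T ⟶ Z}
    (h : ∀ (i : ι) (T' : Over S) (g : T' ⟶ T), (T' ⟶ opensOver (U i)) → g ≫ x = g ≫ y) :
    x = y :=
  Over.OverMorphism.ext <| (restrictCover hU T).hom_ext _ _ fun i =>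
    congrArg (fun k => k.left) (h i _ (restrictIncl T (U i)) (restrictProj T (U i)))

lemma appTop_ext (hU : IsOpenCover U) {T : Over S} {x y : Γ(T.left, ⊤)}
    (h : ∀ (i : ι) (T' : Over S) (g : T' ⟶ T), (T' ⟶ opensOver (U i)) → IsAffine T'.left →
      g.left.appTop.hom x = g.left.appTop.hom y) : x = y := by
  refine (restrictCover hU T).ext_elem _ _ fun i =>
    (restrictOver T (U i)).left.affineCover.ext_elem _ _ fun j => ?_
  let T' : Over S := Over.mk
    ((restrictOver T (U i)).left.affineCover.f j ≫ (restrictOver T (U i)).hom)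
  let g : T' ⟶ restrictOver T (U i) :=
    Over.homMk ((restrictOver T (U i)).left.affineCover.f j) rfl
  have hg := h i T' (g ≫ restrictIncl T (U i)) (g ≫ restrictProj T (U i))
    (inferInstanceAs (IsAffine ((restrictOver T (U i)).left.affineCover.X j)))
  rwa [Over.comp_left, Scheme.Hom.comp_appTop] at hg

lemma global_ext (hU : IsOpenCover U) {x y : Γ(S, ⊤)}
    (h : ∀ i, (U i).ι.appTop.hom x = (U i).ι.appTop.hom y) : x = y :=
  appTop_ext hU (T := Over.mk (𝟙 S)) fun i T g k _ => by
    have hg : g.left = k.left ≫ (U i).ι := by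
      rw [← Category.comp_id g.left]
      exact (Over.w g).trans (Over.w k).symm
    rw [hg, Scheme.Hom.comp_appTop]
    exact congrArg k.left.appTop.hom (h i)

lemma exists_glue (hU : IsOpenCover U) {T Z : Over S} (y : ∀ i, restrictOver T (U i) ⟶ Z)
    (h : ∀ (i j : ι) (T' : Over S) (g : T' ⟶ restrictOver T (U i))
      (g' : T' ⟶ restrictOver T (U j)), IsAffine T'.left →
      g ≫ restrictIncl T (U i) = g' ≫ restrictIncl T (U j) → g ≫ y i = g' ≫ y j) :
    ∃ x : T ⟶ Z, ∀ i, restrictIncl T (U i) ≫ x = y i := by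
  let 𝒰 := restrictCover hU T
  have hcompat (i j : ι) : Limits.pullback.fst (𝒰.f i) (𝒰.f j) ≫ (y i).left =
      Limits.pullback.snd (𝒰.f i) (𝒰.f j) ≫ (y j).left := by
    let T' : Over S := Over.mk (Limits.pullback.fst (𝒰.f i) (𝒰.f j) ≫ 𝒰.f i ≫ T.hom)
    let g : T' ⟶ restrictOver T (U i) := Over.homMk (Limits.pullback.fst (𝒰.f i) (𝒰.f j)) rfl
    let g' : T' ⟶ restrictOver T (U j) := Over.homMk (Limits.pullback.snd (𝒰.f i) (𝒰.f j)) (by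
      change _ ≫ 𝒰.f j ≫ T.hom = _ ≫ 𝒰.f i ≫ T.hom
      rw [Limits.pullback.condition_assoc])
    have hgg' : g ≫ restrictIncl T (U i) = g' ≫ restrictIncl T (U j) :=
      Over.OverMorphism.ext Limits.pullback.condition
    have hg : g ≫ y i = g' ≫ y j := over_hom_ext_of_isAffine fun T'' k hT'' => by
      rw [← Category.assoc, ← Category.assoc]
      exact h i j T'' _ _ hT'' (by rw [Category.assoc, Category.assoc, hgg'])
    exact congrArg (fun k => k.left) hg
  have hι := 𝒰.ι_glueMorphisms (fun i => (y i).left) hcompat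
  refine ⟨Over.homMk (𝒰.glueMorphisms (fun i => (y i).left) hcompat) ?_,
    fun i => Over.OverMorphism.ext (hι i)⟩
  refine 𝒰.hom_ext _ _ fun i => ?_
  rw [← Category.assoc, hι]
  exact Over.w (y i)

end Cover

end Gluing

namespace LineBundle

open Polynomial TopologicalSpace

variable {S : Scheme.{u}} {V W : LineBundle S}

lemma Frame.isBasis {U : S.Opens} (e : V.Frame U) : IsBasis e.sec := e.bijective

/-- The restriction of a frame to a smaller open. -/
noncomputable def Frame.restrict {U U' : S.Opens} (e : V.Frame U) (g : opensOver U' ⟶ opensOver U) :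
    V.Frame U' :=
  ⟨g ≫ e.sec, e.isBasis.comp g⟩

variable {ι : Type u} {U : ι → S.Opens} {e : ∀ i, V.Frame (U i)} {e' : ∀ i, W.Frame (U i)}
  {P : ∀ i, Γ(U i, ⊤)[X]}

lemma exists_hom_of_localExpr (hU : IsOpenCover U)
    (h : ∀ (i j : ι) (T : Over S) (g : T ⟶ opensOver (U i)) (g' : T ⟶ opensOver (U j))
      (c c' : Γ(T.left, ⊤)), IsAffine T.left → c • (g ≫ (e i).sec) = c' • (g' ≫ (e j).sec) →
      (P i).eval₂ g.left.appTop.hom c • (g ≫ (e' i).sec) =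
        (P j).eval₂ g'.left.appTop.hom c' • (g' ≫ (e' j).sec)) :
    ∃ f : V.total ⟶ W.total, ∀ i, LocalExpr f (e i).sec (e' i).sec (P i) := by
  choose c hc using fun i => (e i).isBasis.exists_smul (restrictProj V.total (U i))
    (restrictIncl V.total (U i))
  let y (i : ι) : restrictOver V.total (U i) ⟶ W.total :=
    (P i).eval₂ (restrictProj V.total (U i)).left.appTop.hom (c i) •
      (restrictProj V.total (U i) ≫ (e' i).sec)
  have hy (i : ι) {T : Over S} (k : T ⟶ restrictOver V.total (U i)) : k ≫ y i =
      (P i).eval₂ (k ≫ restrictProj V.total (U i)).left.appTop.hom (k.left.appTop.hom (c i)) •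
        ((k ≫ restrictProj V.total (U i)) ≫ (e' i).sec) := by
    rw [comp_smul, hom_eval₂, Over.comp_left, Scheme.Hom.comp_appTop, CommRingCat.hom_comp,
      Category.assoc]
  obtain ⟨f, hf⟩ := exists_glue hU y fun i j T g g' hT hgg' => by
    rw [hy, hy]
    refine h i j T _ _ _ _ hT ?_
    rw [hc, hc] at hgg'
    simpa only [comp_smul, Category.assoc] using hgg'
  refine ⟨f, fun i T g d => ?_⟩
  obtain ⟨k, hk⟩ := exists_hom_restrictOver (d • (g ≫ (e i).sec)) g
  have hkg := opensOver_hom_subsingleton (k ≫ restrictProj V.total (U i)) g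
  have hd : k.left.appTop.hom (c i) = d := (e i).isBasis.smul_injective g (by
    rw [← hk, hc, comp_smul, ← Category.assoc, hkg])
  rw [← hk, Category.assoc, hf, hy, hkg, hd]

end LineBundle

/-! ### Line bundles as families of affine lines -/

namespace LineBundle

open Polynomial TopologicalSpace

variable {S : Scheme.{u}} {V W : LineBundle S}

section Line

variable (T : Over S) [IsAffine T.left]

/-- The affine line over the affine `S`-scheme `T`. -/
noncomputable abbrev lineOver : Over S := specOver T (C : Γ(T.left, ⊤) →+* Γ(T.left, ⊤)[X])

/-- The structure morphism of the affine line over `T`. -/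
noncomputable abbrev lineProj : lineOver T ⟶ T := specOverProj T C

/-- The identification of polynomials over `T` with functions on the affine line over `T`. -/
noncomputable abbrev lineEquiv : Γ(T.left, ⊤)[X] ≃+* Γ((lineOver T).left, ⊤) := specOverEquiv T C

variable {T}

lemma eval₂_lineProj (F Q : Γ(T.left, ⊤)[X]) :
    F.eval₂ (lineProj T).left.appTop.hom (lineEquiv T Q) = lineEquiv T (F.comp Q) :=
  eval₂_specOverProj T C F Q

/-- The parametrization `c ↦ c • b` of a line bundle over `T` by the affine line. -/
noncomputable def param (b : T ⟶ V.total) : lineOver T ⟶ V.total :=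
  lineEquiv T X • (lineProj T ≫ b)

lemma comp_param (b : T ⟶ V.total) {Y : Over S} (k : Y ⟶ lineOver T) :
    k ≫ param b = k.left.appTop.hom (lineEquiv T X) • ((k ≫ lineProj T) ≫ b) := by
  rw [param, comp_smul, Category.assoc]

lemma exists_hom_lineOver {Y : Over S} (g : Y ⟶ T) (c : Γ(Y.left, ⊤)) :
    ∃ k : Y ⟶ lineOver T, k ≫ lineProj T = g ∧ k.left.appTop.hom (lineEquiv T X) = c := by
  obtain ⟨k, hkg, hk⟩ := exists_hom_specOver (φ := C) g (eval₂RingHom g.left.appTop.hom c)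
    (RingHom.ext fun _ => eval₂_C _ _)
  exact ⟨k, hkg, (hk X).trans (eval₂_X _ _)⟩

lemma lineOver_appTop {Y : Over S} (k : Y ⟶ lineOver T) (F : Γ(T.left, ⊤)[X]) :
    k.left.appTop.hom (lineEquiv T F) =
      F.eval₂ (k ≫ lineProj T).left.appTop.hom (k.left.appTop.hom (lineEquiv T X)) := by
  rw [Over.comp_left, Scheme.Hom.comp_appTop, CommRingCat.hom_comp, ← hom_eval₂,
    eval₂_lineProj, comp_X]

lemma lineOver_hom_ext {Y : Over S} {k k' : Y ⟶ lineOver T}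
    (h : k ≫ lineProj T = k' ≫ lineProj T)
    (hX : k.left.appTop.hom (lineEquiv T X) = k'.left.appTop.hom (lineEquiv T X)) : k = k' := by
  refine specOver_hom_ext fun F => ?_
  rw [lineOver_appTop k, lineOver_appTop k', h, hX]

lemma isPullback_param {b : T ⟶ V.total} (hb : IsBasis b) :
    IsPullback (param b).left (lineProj T).left V.total.hom T.hom := by
  refine ⟨⟨(Over.w _).trans (Over.w _).symm⟩, ⟨Limits.PullbackCone.isLimitAux' _ fun s => ?_⟩⟩
  apply Classical.choice
  let Y : Over S := Over.mk (s.snd ≫ T.hom)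
  let z : Y ⟶ V.total := Over.homMk s.fst s.condition
  let g : Y ⟶ T := Over.homMk s.snd rfl
  obtain ⟨c, hc⟩ := hb.exists_smul g z
  obtain ⟨k, hkg, hkc⟩ := exists_hom_lineOver g c
  have hkz : k ≫ param b = z := by rw [comp_param, hkc, hkg, hc]
  refine ⟨k.left, congrArg (fun k => k.left) hkz, congrArg (fun k => k.left) hkg,
    fun {m} hm_fst hm_snd => ?_⟩
  let m' : Y ⟶ lineOver T := Over.homMk m <|
    (m ≫= (Over.w (lineProj T)).symm).trans <|
      (Category.assoc _ _ _).symm.trans (hm_snd =≫ T.hom)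
  have hm'g : m' ≫ lineProj T = g := Over.OverMorphism.ext hm_snd
  have hm'z : m' ≫ param b = z := Over.OverMorphism.ext hm_fst
  have hm'k : m' = k := lineOver_hom_ext (hm'g.trans hkg.symm) <| hb.smul_injective g <| by
    rw [hkc, ← hc, ← hm'z, comp_param, hm'g]
  exact congrArg (fun k => k.left) hm'k

/-- The morphism `c ↦ Q(c)` of the affine line. -/
noncomputable def lineMap (Q : Γ(T.left, ⊤)[X]) : lineOver T ⟶ lineOver T :=
  Over.homMk (Spec.map (CommRingCat.ofHom (compRingHom Q))) (by
    change Spec.map _ ≫ Spec.map _ ≫ _ = Spec.map _ ≫ _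
    rw [← Spec.map_comp_assoc]
    congr 2
    ext x
    simp)

lemma lineMap_comp_lineProj (Q : Γ(T.left, ⊤)[X]) : lineMap Q ≫ lineProj T = lineProj T := by
  apply Over.OverMorphism.ext
  change Spec.map _ ≫ Spec.map _ ≫ _ = Spec.map _ ≫ _
  rw [← Spec.map_comp_assoc]
  congr 2
  ext x
  simp

lemma lineMap_appTop (Q F : Γ(T.left, ⊤)[X]) :
    (lineMap Q).left.appTop.hom (lineEquiv T F) = lineEquiv T (F.comp Q) := by
  change ((Scheme.ΓSpecIso _).inv ≫ (Spec.map (CommRingCat.ofHom (compRingHom Q))).appTop) F =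
    (CommRingCat.ofHom (compRingHom Q) ≫ (Scheme.ΓSpecIso _).inv) F
  rw [Scheme.ΓSpecIso_inv_naturality]

section LocalExpr

variable {f : V.total ⟶ W.total} {b : T ⟶ V.total} {b' : T ⟶ W.total} {Q : Γ(T.left, ⊤)[X]}

lemma LocalExpr.isPullback (h : LocalExpr f b b' Q) (hb : IsBasis b) (hb' : IsBasis b') :
    IsPullback (param b).left (lineMap Q).left f.left (param b').left := by
  have hcomm : param b ≫ f = lineMap Q ≫ param b' := by
    rw [comp_param, lineMap_appTop, lineMap_comp_lineProj, X_comp, param, h, eval₂_lineProj,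
      comp_X]
  refine IsPullback.of_bot (v₂₁ := (lineProj T).left) (v₂₂ := W.total.hom) (h₃₁ := T.hom)
    ?_ (congrArg (fun k => k.left) hcomm) (isPullback_param hb')
  rw [← Over.comp_left, lineMap_comp_lineProj, Over.w f]
  exact isPullback_param hb

lemma LocalExpr.finite (h : LocalExpr f b b' Q) (hb : IsBasis b) (hb' : IsBasis b')
    (hf : IsFinite f.left) : (compRingHom Q).Finite :=
  (IsFinite.SpecMap_iff (CommRingCat.ofHom (compRingHom Q))).1 <|
    MorphismProperty.of_isPullback (P := @IsFinite) (h.isPullback hb hb') hf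

lemma LocalExpr.flat (h : LocalExpr f b b' Q) (hb : IsBasis b) (hb' : IsBasis b')
    (hf : Flat f.left) : (compRingHom Q).Flat :=
  (Flat.SpecMap_iff (f := CommRingCat.ofHom (compRingHom Q))).1 <|
    MorphismProperty.of_isPullback (P := @Flat) (h.isPullback hb hb') hf

lemma LocalExpr.finrank (h : LocalExpr f b b' Q) (hb : IsBasis b) (hb' : IsBasis b')
    (hf : IsFinite f.left) (hf' : Flat f.left) (x : (lineOver T).left) :
    f.left.finrank ((param b').left x) = (compRingHom Q).finrank x := by
  rw [← Scheme.Hom.finrank_of_isPullback _ _ _ _ (h.isPullback hb hb') x]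
  exact congrFun (Scheme.Hom.finrank_SpecMap_eq_finrank
    (f := CommRingCat.ofHom (compRingHom Q)) (h.finite hb hb' hf) (h.flat hb hb' hf')) x

end LocalExpr

end Line

section Cover

variable {U : S.Opens} [IsAffine (opensOver U).left] {b : opensOver U ⟶ V.total}

lemma isOpenImmersion_param (hb : IsBasis b) : IsOpenImmersion (param b).left :=
  MorphismProperty.of_isPullback (P := @IsOpenImmersion) (isPullback_param hb).flip
    (inferInstanceAs (IsOpenImmersion U.ι))

lemma exists_param_eq (hb : IsBasis b) {y : V.total.left} (hy : V.total.hom y ∈ U) :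
    ∃ x, (param b).left x = y := by
  obtain ⟨x, hx, -⟩ := Scheme.exists_preimage_of_isPullback (isPullback_param hb) y
    (⟨V.total.hom y, hy⟩ : U) rfl
  exact ⟨x, hx⟩

variable {ι : Type u} {U : ι → S.Opens} [∀ i, IsAffine (opensOver (U i)).left]
  {e : ∀ i, V.Frame (U i)} {e' : ∀ i, W.Frame (U i)}

/-- The open cover of the total space of a line bundle by affine lines. -/
noncomputable def paramCover (hU : IsOpenCover U) (e : ∀ i, V.Frame (U i)) :
    V.total.left.OpenCover where
  I₀ := ι
  X i := (lineOver (opensOver (U i))).left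
  f i := (param (e i).sec).left
  mem₀ := by
    rw [Scheme.presieve₀_mem_precoverage_iff]
    refine ⟨fun y => ?_, fun i => isOpenImmersion_param (e i).isBasis⟩
    obtain ⟨i, hi⟩ := hU.exists_mem (V.total.hom y)
    exact ⟨i, exists_param_eq (e i).isBasis hi⟩

variable {f : V.total ⟶ W.total} {Q : ∀ i, Γ(U i, ⊤)[X]}

lemma of_localExpr {P : MorphismProperty Scheme.{u}} [IsZariskiLocalAtTarget P]
    (hU : IsOpenCover U) (h : ∀ i, LocalExpr f (e i).sec (e' i).sec (Q i))
    (hP : ∀ i, P (lineMap (T := opensOver (U i)) (Q i)).left) : P f.left := by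
  refine IsZariskiLocalAtTarget.of_openCover (𝒰 := paramCover hU e') fun (i : ι) => ?_
  have hpullback := (h i).isPullback (e i).isBasis (e' i).isBasis
  change P (Limits.pullback.snd f.left (param (e' i).sec).left)
  rw [← hpullback.isoPullback_inv_snd, P.cancel_left_of_respectsIso]
  exact hP i

/-- Instance search misses this: the type of `@IsFinite` is not syntactically `MorphismProperty`. -/
lemma isZariskiLocalAtTarget_isFinite : IsZariskiLocalAtTarget @IsFinite.{u} :=
  (HasAffineProperty.iff.1 ((HasAffineProperty.affineAnd_iff _ RingHom.finite_respectsIso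
    RingHom.finite_localizationPreserves.away RingHom.finite_ofLocalizationSpan).2
    fun f => isFinite_iff f)).1

lemma isZariskiLocalAtTarget_flat : IsZariskiLocalAtTarget @Flat.{u} :=
  (HasAffineProperty.iff.1 (HasRingHomProperty.HasAffineProperty (P := @Flat))).1

lemma isFinite_of_localExpr (hU : IsOpenCover U)
    (h : ∀ i, LocalExpr f (e i).sec (e' i).sec (Q i))
    (hQ : ∀ i, (compRingHom (Q i)).Finite) : IsFinite f.left :=
  haveI := isZariskiLocalAtTarget_isFinite.{u}
  of_localExpr (P := @IsFinite) hU h fun i => (IsFinite.SpecMap_iff (CommRingCat.ofHom _)).2 (hQ i)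

lemma flat_of_localExpr (hU : IsOpenCover U)
    (h : ∀ i, LocalExpr f (e i).sec (e' i).sec (Q i))
    (hQ : ∀ i, (compRingHom (Q i)).Flat) : Flat f.left :=
  haveI := isZariskiLocalAtTarget_flat.{u}
  of_localExpr (P := @Flat) hU h fun i => (Flat.SpecMap_iff (f := CommRingCat.ofHom _)).2 (hQ i)

lemma finrank_of_localExpr (hU : IsOpenCover U)
    (h : ∀ i, LocalExpr f (e i).sec (e' i).sec (Q i))
    (hQ : ∀ i, (compRingHom (Q i)).Finite) (hQ' : ∀ i, (compRingHom (Q i)).Flat) {n : ℕ}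
    (hn : ∀ i x, (compRingHom (Q i)).finrank x = n) (y : W.total.left) :
    f.left.finrank y = n := by
  obtain ⟨i, hi⟩ := hU.exists_mem (W.total.hom y)
  obtain ⟨x, rfl⟩ := exists_param_eq (e' i).isBasis hi
  rw [← hn i x]
  exact (h i).finrank (e i).isBasis (e' i).isBasis (isFinite_of_localExpr hU h hQ)
    (flat_of_localExpr hU h hQ') x

end Cover

end LineBundle

/-! ### Frobenius twists of line bundles -/

section Frobenius

/-- The iterated Frobenius `x ↦ x ^ p ^ k` of a ring in which `p = 0`. Mathlib's `iterateFrobenius`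
excludes the zero ring, which occurs among the rings of sections of a scheme. -/
def powCharPowHom {p : ℕ} (hp : p.Prime) (k : ℕ) {R : Type*} [CommRing R] (hR : (p : R) = 0) :
    R →+* R where
  toFun x := x ^ p ^ k
  map_one' := one_pow _
  map_mul' x y := mul_pow x y _
  map_zero' := zero_pow (pow_ne_zero k hp.ne_zero)
  map_add' x y := by
    rcases subsingleton_or_nontrivial R with h | h
    · exact Subsingleton.elim _ _
    · have : Fact p.Prime := ⟨hp⟩
      have : CharP R p := (CharP.charP_iff_prime_eq_zero hp).2 hR
      exact add_pow_char_pow x y p k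

lemma natCast_section_eq_zero {p : ℕ} {X : Scheme.{u}} (hX : (p : Γ(X, ⊤)) = 0) (U : X.Opens) :
    (p : Γ(X, U)) = 0 := by
  rw [← map_natCast (X.presheaf.map (homOfLE (le_top : U ≤ ⊤)).op).hom, hX, map_zero]

lemma natCast_appTop_eq_zero {p : ℕ} {X Y : Scheme.{u}} (f : Y ⟶ X) (hX : (p : Γ(X, ⊤)) = 0) :
    (p : Γ(Y, ⊤)) = 0 := by
  rw [← map_natCast f.appTop.hom, hX, map_zero]

variable {p : ℕ} (hp : p.Prime) (k : ℕ)

/-- The underlying morphism of presheafed spaces of the iterated absolute Frobenius. -/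
noncomputable def absFrobeniusPresheafedSpace (X : Scheme.{u}) (hX : (p : Γ(X, ⊤)) = 0) :
    X.toPresheafedSpace.Hom X.toPresheafedSpace where
  base := 𝟙 _
  c :=
    { app := fun U => CommRingCat.ofHom
        (powCharPowHom hp k (natCast_section_eq_zero hX U.unop))
      naturality := fun U V i => by
        ext x
        exact (map_pow (X.presheaf.map i).hom x (p ^ k)).symm }

/-- The iterated absolute Frobenius of a scheme of characteristic `p`. -/
noncomputable def absFrobenius (X : Scheme.{u}) (hX : (p : Γ(X, ⊤)) = 0) : X ⟶ X :=
  ⟨⟨absFrobeniusPresheafedSpace hp k X hX, fun x => ⟨fun a ha => by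
    obtain ⟨U, hxU, s, rfl⟩ := TopCat.Presheaf.exists_germ_eq X.presheaf a
    have hstalk : ((absFrobeniusPresheafedSpace hp k X hX).stalkMap x).hom
        ((X.presheaf.germ U x hxU).hom s) = ((X.presheaf.germ U x hxU).hom s) ^ p ^ k := by
      rw [← map_pow]
      exact congr($(PresheafedSpace.stalkMap_germ
        (absFrobeniusPresheafedSpace hp k X hX) U x hxU) s)
    refine (isUnit_pow_iff (pow_ne_zero k hp.ne_zero)).1 ?_
    exact hstalk ▸ ha⟩⟩⟩

lemma absFrobenius_comp {X Y : Scheme.{u}} (f : Y ⟶ X) (hX : (p : Γ(X, ⊤)) = 0) :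
    absFrobenius hp k Y (natCast_appTop_eq_zero f hX) ≫ f = f ≫ absFrobenius hp k X hX := by
  refine Scheme.Hom.ext rfl fun U => ?_
  ext x
  refine (congr($(Y.presheaf.map_id _) _)).trans ?_
  exact (map_pow (f.app U).hom x (p ^ k)).symm

end Frobenius

namespace LineBundle

variable {S : Scheme.{u}} {p : ℕ} (hp : p.Prime) (k : ℕ) (hS : (p : Γ(S, ⊤)) = 0)

/-- The `S`-scheme `T`, with its structure morphism composed with the Frobenius of `S`. -/
noncomputable abbrev frobeniusOver (T : Over S) : Over S :=
  (Over.map (absFrobenius hp k S hS)).obj T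

/-- The relative Frobenius of `T` over `S`. -/
noncomputable def relFrobenius (T : Over S) : frobeniusOver hp k hS T ⟶ T :=
  Over.homMk (absFrobenius hp k T.left (natCast_appTop_eq_zero T.hom hS))
    (absFrobenius_comp hp k T.hom hS)

lemma relFrobenius_naturality {T T' : Over S} (g : T' ⟶ T) :
    relFrobenius hp k hS T' ≫ g =
      (Over.map (absFrobenius hp k S hS)).map g ≫ relFrobenius hp k hS T :=
  Over.OverMorphism.ext (absFrobenius_comp hp k g.left _)

/-- The total space of the Frobenius twist of `V`: the pullback of `V` by the Frobenius of `S`. -/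
noncomputable abbrev twistTotal (V : LineBundle S) : Over S :=
  (Over.pullback (absFrobenius hp k S hS)).obj V.total

/-- Sections over `T` of the twist of `V` are sections of `V` over `T`, viewed as an `S`-scheme via
the Frobenius of `S`. -/
noncomputable def twistEquiv (V : LineBundle S) (T : Over S) :
    (T ⟶ twistTotal hp k hS V) ≃ (frobeniusOver hp k hS T ⟶ V.total) :=
  ((Over.mapPullbackAdj (absFrobenius hp k S hS)).homEquiv T V.total).symm

lemma twistEquiv_comp (V : LineBundle S) {T T' : Over S} (g : T' ⟶ T)
    (x : T ⟶ twistTotal hp k hS V) :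
    twistEquiv hp k hS V T' (g ≫ x) =
      (Over.map (absFrobenius hp k S hS)).map g ≫ twistEquiv hp k hS V T x :=
  Adjunction.homEquiv_naturality_left_symm _ _ _

/-- The relative Frobenius from `V` to the total space of its twist. -/
noncomputable def twistMap (V : LineBundle S) : V.total ⟶ twistTotal hp k hS V :=
  (twistEquiv hp k hS V V.total).symm (relFrobenius hp k hS V.total)

lemma twistEquiv_comp_twistMap (V : LineBundle S) {T : Over S} (x : T ⟶ V.total) :
    twistEquiv hp k hS V T (x ≫ twistMap hp k hS V) = relFrobenius hp k hS T ≫ x := by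
  rw [twistEquiv_comp, twistMap, Equiv.apply_symm_apply, relFrobenius_naturality]

noncomputable instance twistAddCommGroup (V : LineBundle S) (T : Over S) :
    AddCommGroup (T ⟶ twistTotal hp k hS V) :=
  (twistEquiv hp k hS V T).addCommGroup

noncomputable instance twistModule (V : LineBundle S) (T : Over S) :
    Module Γ(T.left, ⊤) (T ⟶ twistTotal hp k hS V) :=
  letI : Module Γ(T.left, ⊤) (frobeniusOver hp k hS T ⟶ V.total) :=
    V.module (frobeniusOver hp k hS T)
  (twistEquiv hp k hS V T).module _

lemma twistEquiv_add (V : LineBundle S) {T : Over S} (x y : T ⟶ twistTotal hp k hS V) :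
    twistEquiv hp k hS V T (x + y) = twistEquiv hp k hS V T x + twistEquiv hp k hS V T y :=
  (twistEquiv hp k hS V T).apply_symm_apply _

lemma twistEquiv_smul (V : LineBundle S) {T : Over S} (c : Γ(T.left, ⊤))
    (x : T ⟶ twistTotal hp k hS V) : twistEquiv hp k hS V T (c • x) =
      @HSMul.hSMul Γ((frobeniusOver hp k hS T).left, ⊤) _ _ _ c (twistEquiv hp k hS V T x) :=
  (twistEquiv hp k hS V T).apply_symm_apply _

lemma smul_comp_twistMap (V : LineBundle S) {T : Over S} (c : Γ(T.left, ⊤)) (x : T ⟶ V.total) :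
    (c • x) ≫ twistMap hp k hS V = c ^ p ^ k • (x ≫ twistMap hp k hS V) := by
  apply (twistEquiv hp k hS V T).injective
  rw [twistEquiv_smul, twistEquiv_comp_twistMap, twistEquiv_comp_twistMap, comp_smul]
  rfl

lemma twistMap_bijective (V : LineBundle S) {T : Over S} {b : T ⟶ V.total} (hb : IsBasis b)
    {T' : Over S} (g : T' ⟶ T) : Function.Bijective fun c : Γ(T'.left, ⊤) =>
      c • (g ≫ b ≫ twistMap hp k hS V) := by
  rw [← (twistEquiv hp k hS V T').comp_bijective]
  have hcomp : (twistEquiv hp k hS V T' ∘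
        fun c : Γ(T'.left, ⊤) => c • (g ≫ b ≫ twistMap hp k hS V)) =
      fun c : Γ((frobeniusOver hp k hS T').left, ⊤) => c • ((relFrobenius hp k hS T' ≫ g) ≫ b) := by
    funext c
    rw [Function.comp_apply, twistEquiv_smul, ← Category.assoc, twistEquiv_comp_twistMap,
      Category.assoc]
  rw [hcomp]
  exact hb _ _

/-- The iterated Frobenius twist of a line bundle. -/
noncomputable def twist (V : LineBundle S) : LineBundle S where
  total := twistTotal hp k hS V
  addCommGroup := inferInstance
  module := inferInstance
  comp_add g x y := (twistEquiv hp k hS V _).injective <| by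
    rw [twistEquiv_comp, twistEquiv_add, comp_add, twistEquiv_add, twistEquiv_comp,
      twistEquiv_comp]
  comp_smul g c x := (twistEquiv hp k hS V _).injective <| by
    rw [twistEquiv_comp, twistEquiv_smul, comp_smul, twistEquiv_smul, twistEquiv_comp]
    rfl
  exists_frame s := by
    obtain ⟨U, hs, hU, e, he⟩ := V.exists_frame s
    exact ⟨U, hs, hU, e ≫ twistMap hp k hS V, fun T g => twistMap_bijective hp k hS V he g⟩

/-- `twistMap`, as a morphism to the line bundle `V.twist hp k hS`. -/
noncomputable def toTwist (V : LineBundle S) : V.total ⟶ (V.twist hp k hS).total :=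
  twistMap hp k hS V

lemma IsBasis.comp_toTwist {V : LineBundle S} {T : Over S} {b : T ⟶ V.total} (hb : IsBasis b) :
    IsBasis (V := V.twist hp k hS) (b ≫ V.toTwist hp k hS) :=
  fun _ g => twistMap_bijective hp k hS V hb g

lemma smul_comp_toTwist (V : LineBundle S) {T : Over S} (c : Γ(T.left, ⊤)) (x : T ⟶ V.total) :
    (c • x) ≫ V.toTwist hp k hS = c ^ p ^ k • (x ≫ V.toTwist hp k hS) :=
  smul_comp_twistMap hp k hS V c x

end LineBundle

/-! ### Local equations of closed subgroups -/

section Factorization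

lemma exists_comp_eq_iff_ker_le {X Y Z : Scheme.{u}} [IsAffine X] [IsAffine Z] {i : Z ⟶ X}
    (hi : Function.Surjective i.appTop.hom) (k : Y ⟶ X) :
    (∃ l, l ≫ i = k) ↔ ∀ x, i.appTop.hom x = 0 → k.appTop.hom x = 0 := by
  constructor
  · rintro ⟨l, rfl⟩ x hx
    rw [Scheme.Hom.comp_appTop, CommRingCat.hom_comp, RingHom.comp_apply, hx, map_zero]
  · intro h
    let g : {g : Γ(X, ⊤) →+* Γ(Y, ⊤) // RingHom.ker i.appTop.hom ≤ RingHom.ker g} :=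
      ⟨k.appTop.hom, h⟩
    have hlift : (RingHom.liftOfSurjective i.appTop.hom hi g).comp i.appTop.hom = k.appTop.hom :=
      RingHom.liftOfRightInverse_comp _ _ _ g
    obtain ⟨l, hl⟩ := exists_hom_appTop_eq (RingHom.liftOfSurjective i.appTop.hom hi g)
    refine ⟨l, ext_of_isAffine (CommRingCat.hom_ext ?_)⟩
    rw [Scheme.Hom.comp_appTop, CommRingCat.hom_comp, hl, hlift]

lemma exists_over_comp_eq_iff {S Z : Scheme.{u}} {G L V Y : Over S} {i : G ⟶ V} {j : L ⟶ V}
    {fst : Z ⟶ G.left} {snd : Z ⟶ L.left} (h : IsPullback fst snd i.left j.left) (k : Y ⟶ L) :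
    (∃ y : Y ⟶ G, y ≫ i = k ≫ j) ↔ ∃ l, l ≫ snd = k.left := by
  constructor
  · rintro ⟨y, hy⟩
    exact ⟨_, h.lift_snd y.left k.left (congrArg (fun f => f.left) hy)⟩
  · rintro ⟨l, hl⟩
    have hcomp : (l ≫ fst) ≫ i.left = (k ≫ j).left := by
      rw [Category.assoc, h.w, ← Category.assoc, hl, Over.comp_left]
    refine ⟨Over.homMk (l ≫ fst) ?_, Over.OverMorphism.ext hcomp⟩
    rw [← Over.w i, ← Category.assoc, hcomp, Over.w]

end Factorization

namespace LineBundle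

open Polynomial TopologicalSpace

variable {S : Scheme.{u}} {V : LineBundle S}

namespace ClosedSubgroup

lemma exists_algebra (G : V.ClosedSubgroup) (hfin : IsFinite G.obj.hom)
    (hflat : Flat G.obj.hom) {T : Over S} [IsAffine T.left] {b : T ⟶ V.total} (hb : IsBasis b) :
    ∃ (Q : Type u) (_ : CommRing Q) (_ : Algebra Γ(T.left, ⊤) Q)
      (q : Γ(T.left, ⊤)[X] →ₐ[Γ(T.left, ⊤)] Q),
      Function.Surjective q ∧ Module.Finite Γ(T.left, ⊤) Q ∧ Module.Flat Γ(T.left, ⊤) Q ∧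
      ∀ (Y : Over S) (g : Y ⟶ T) (c : Γ(Y.left, ⊤)),
        (∃ y : Y ⟶ G.obj, y ≫ G.incl = c • (g ≫ b)) ↔
          ∀ f, q f = 0 → f.eval₂ g.left.appTop.hom c = 0 := by
  have hincl := G.isClosedImmersion
  let fst := Limits.pullback.fst G.incl.left (param b).left
  let snd : _ ⟶ (lineOver T).left := Limits.pullback.snd G.incl.left (param b).left
  have hsnd : IsPullback fst snd G.incl.left (param b).left := IsPullback.of_hasPullback _ _
  have hproj : IsPullback fst (snd ≫ (lineProj T).left) G.obj.hom T.hom := by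
    rw [← Over.w G.incl]
    exact hsnd.paste_vert (isPullback_param hb)
  have : IsClosedImmersion snd := MorphismProperty.of_isPullback hsnd hincl
  have : IsFinite (snd ≫ (lineProj T).left) := MorphismProperty.of_isPullback hproj hfin
  have : Flat (snd ≫ (lineProj T).left) := MorphismProperty.of_isPullback hproj hflat
  obtain ⟨hZ, hsurj⟩ := IsClosedImmersion.isAffine_surjective_of_isAffine snd
  let _ := (snd ≫ (lineProj T).left).appTop.hom.toAlgebra
  let q : Γ(T.left, ⊤)[X] →ₐ[Γ(T.left, ⊤)] Γ(Limits.pullback G.incl.left (param b).left, ⊤) :=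
    { snd.appTop.hom.comp (lineEquiv T).toRingHom with
      commutes' := fun r =>
        congrArg snd.appTop.hom (RingHom.congr_fun (specOverProj_appTop T C) r).symm }
  refine ⟨_, inferInstance, inferInstance, q, hsurj.comp (lineEquiv T).surjective,
    IsFinite.finite_app _ ⊤ (isAffineOpen_top _), Scheme.Hom.flat_appTop _, fun Y g c => ?_⟩
  obtain ⟨k, rfl, rfl⟩ := exists_hom_lineOver g c
  rw [← comp_param, exists_over_comp_eq_iff hsnd, exists_comp_eq_iff_ker_le hsurj]
  simp only [← lineOver_appTop]
  exact (lineEquiv T).surjective.forall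

/-- With respect to the section `b` over `T`, the subgroup `G` is the zero locus of the monic
polynomial `P`. For frames over an open of `S` this is `IsLocalEquation`. -/
def LocalEq (G : V.ClosedSubgroup) {T : Over S} (b : T ⟶ V.total) (P : Γ(T.left, ⊤)[X]) : Prop :=
  P.Monic ∧ ∀ (T' : Over S) (g : T' ⟶ T) (c : Γ(T'.left, ⊤)),
    (∃ y : T' ⟶ G.obj, y ≫ G.incl = c • (g ≫ b)) ↔ P.eval₂ g.left.appTop.hom c = 0

namespace LocalEq

variable {G : V.ClosedSubgroup} {T : Over S} {b b' : T ⟶ V.total} {P P' : Γ(T.left, ⊤)[X]}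

lemma restrict (h : G.LocalEq b P) {T' : Over S} (g : T' ⟶ T) :
    G.LocalEq (g ≫ b) (P.map g.left.appTop.hom) :=
  ⟨h.1.map _, fun T'' g' c => by
    rw [eval₂_map, ← Category.assoc, h.2 T'' (g' ≫ g) c, Over.comp_left, Scheme.Hom.comp_appTop,
      CommRingCat.hom_comp]⟩

lemma dvd [IsAffine T.left] (h : G.LocalEq b P) (h' : G.LocalEq b P') : P ∣ P' :=
  dvd_of_forall_eval₂ fun T' g c hc => (h'.2 T' g c).1 ((h.2 T' g c).2 hc)

lemma unique [IsAffine T.left] (h : G.LocalEq b P) (h' : G.LocalEq b P') : P = P' := by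
  rcases subsingleton_or_nontrivial Γ(T.left, ⊤) with hT | hT
  · exact Subsingleton.elim _ _
  · exact (eq_of_monic_of_dvd_of_natDegree_le h.1 h'.1 (h.dvd h')
      (le_of_not_gt fun hlt => h'.1.not_dvd_of_natDegree_lt h.1.ne_zero hlt (h'.dvd h))).symm

lemma scaleRoots {u : Γ(T.left, ⊤)ˣ} (h : G.LocalEq ((u : Γ(T.left, ⊤)) • b) P) :
    G.LocalEq b (P.scaleRoots (u : Γ(T.left, ⊤))) := by
  refine ⟨(monic_scaleRoots_iff _).2 h.1, fun T' g c => ?_⟩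
  have hu : IsUnit (g.left.appTop.hom (u : Γ(T.left, ⊤))) := u.isUnit.map _
  obtain ⟨d, rfl⟩ := hu.dvd (a := c)
  rw [scaleRoots_eval₂_mul, (hu.pow _).mul_right_eq_zero, ← h.2 T' g d, comp_smul, smul_smul,
    mul_comm]

lemma natDegree_eq [IsAffine T.left] (h : G.LocalEq b P) (h' : G.LocalEq b' P')
    (hb : IsBasis b) (hb' : IsBasis b') : P.natDegree = P'.natDegree := by
  obtain ⟨u, rfl⟩ := hb.exists_unit hb'
  rw [h'.unique h.scaleRoots, natDegree_scaleRoots]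

lemma eval₂_eq [IsAffine T.left] {u : Γ(T.left, ⊤)ˣ}
    (h : G.LocalEq ((u : Γ(T.left, ⊤)) • b) P) (h' : G.LocalEq b P') (c : Γ(T.left, ⊤)) :
    P'.eval (u * c) = u ^ P.natDegree * P.eval c := by
  rw [h'.unique h.scaleRoots]
  exact scaleRoots_eval₂_mul (RingHom.id _) _ _

lemma coeff_zero (h : G.LocalEq b P) : P.coeff 0 = 0 := by
  obtain ⟨z, hz⟩ := G.exists_zero T
  have hzero := (h.2 T (𝟙 T) 0).1 ⟨z, by rw [hz, zero_smul]⟩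
  rwa [eval₂_at_zero, Over.id_left, Scheme.Hom.id_appTop] at hzero

lemma dvd_taylor [IsAffine T.left] (h : G.LocalEq b P) {R' : Type u} [CommRing R']
    {φ : Γ(T.left, ⊤) →+* R'} {a : R'} (ha : P.eval₂ φ a = 0) :
    P.map φ ∣ taylor a (P.map φ) :=
  dvd_of_forall_eval₂_of_hom φ fun T' g ψ hψ c hc => by
    rw [eval₂_map, hψ] at hc
    obtain ⟨x, hx⟩ := (h.2 T' g c).2 hc
    obtain ⟨y, hy⟩ := (h.2 T' g (ψ a)).2 (by rw [← hψ, ← hom_eval₂, ha, map_zero])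
    obtain ⟨z, hz⟩ := G.exists_add T' x y
    have hadd := (h.2 T' g (c + ψ a)).1 ⟨z, by rw [hz, hx, hy, add_smul]⟩
    rwa [taylor_apply, eval₂_comp, eval₂_add, eval₂_X, eval₂_C, eval₂_map, hψ]

lemma isAdditive [IsAffine T.left] (h : G.LocalEq b P) {p : ℕ} (hp : p.Prime)
    (hT : (p : Γ(T.left, ⊤)) = 0) : AdditivePolynomial.IsAdditive P :=
  AdditivePolynomial.isAdditive_of_dvd_taylor hp hT h.1 h.coeff_zero
    (h.dvd_taylor (AdjoinRoot.eval₂_root P))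

end LocalEq

end ClosedSubgroup

lemma isUnit_of_basicOpen_eq_top {X : Scheme.{u}} {f : Γ(X, ⊤)} (h : X.basicOpen f = ⊤) :
    IsUnit f :=
  X.toRingedSpace.isUnit_of_isUnit_germ ⊤ f fun x hx =>
    (X.mem_basicOpen f x hx).1 (h.symm ▸ hx)

instance {U : S.Opens} [h : IsAffine (U : Scheme.{u})] : IsAffine (opensOver U).left := h

lemma exists_isUnit_restrict {U : S.Opens} (hU : IsAffineOpen U) {s : S} (hs : s ∈ U)
    {r : Γ(U, ⊤)} (hr : (⟨s, hs⟩ : U) ∈ (U : Scheme.{u}).basicOpen r) :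
    ∃ (U' : S.Opens) (g : opensOver U' ⟶ opensOver U), s ∈ U' ∧ IsAffineOpen U' ∧
      IsUnit (g.left.appTop.hom r) := by
  have : IsAffine (U : Scheme.{u}) := hU
  let D := (U : Scheme.{u}).basicOpen r
  obtain ⟨g⟩ : Nonempty (opensOver (U.ι ''ᵁ D) ⟶ opensOver U) :=
    nonempty_hom_opensOver fun x => U.ι_image_le D x.2
  refine ⟨U.ι ''ᵁ D, g, ⟨⟨s, hs⟩, hr, rfl⟩,
    ((isAffineOpen_top (U : Scheme.{u})).basicOpen r).image_of_isOpenImmersion U.ι, ?_⟩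
  refine isUnit_of_basicOpen_eq_top ?_
  rw [← Scheme.preimage_basicOpen_top]
  refine top_le_iff.1 fun x _ => ?_
  obtain ⟨y, hy, hyx⟩ := x.2
  have hgx : U.ι (g.left x) = (U.ι ''ᵁ D).ι x := congr($(Over.w g) x)
  have hgy : g.left x = y := U.ι.isOpenEmbedding.injective (hgx.trans hyx.symm)
  change g.left x ∈ D
  exact hgy ▸ hy

theorem ClosedSubgroup.exists_localEq [IsLocallyNoetherian S] (G : V.ClosedSubgroup)
    (hfin : IsFinite G.obj.hom) (hflat : Flat G.obj.hom) (s : S) :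
    ∃ U : S.Opens, s ∈ U ∧ IsAffineOpen U ∧
      ∃ (e : V.Frame U) (P : Γ(U, ⊤)[X]), G.LocalEq e.sec P := by
  obtain ⟨U, hs, hU, b, hb⟩ := V.exists_frame s
  have : IsAffine (U : Scheme.{u}) := hU
  have : IsNoetherianRing Γ((opensOver U).left, ⊤) :=
    IsLocallyNoetherian.component_noetherian (X := (U : Scheme.{u})) ⟨⊤, isAffineOpen_top _⟩
  obtain ⟨Q, _, _, q, hq, _, _, hzero⟩ := G.exists_algebra hfin hflat (T := opensOver U) hb
  obtain ⟨r, hr, hmonic⟩ := exists_monic_of_flat hq ((U : Scheme.{u}).toSpecΓ ⟨s, hs⟩)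
  obtain ⟨U', g, hs', hU', hunit⟩ := exists_isUnit_restrict hU hs (r := r) <| by
    rw [← Scheme.toSpecΓ_preimage_basicOpen]
    exact hr
  obtain ⟨P, hPm, hP⟩ := hmonic g.left.appTop.hom hunit
  refine ⟨U', hs', hU', Frame.restrict ⟨b, hb⟩ g, P, hPm, fun T' g' c => ?_⟩
  rw [← hP g'.left.appTop.hom c, Frame.restrict, ← Category.assoc, hzero T' (g' ≫ g) c,
    Over.comp_left, Scheme.Hom.comp_appTop, CommRingCat.hom_comp]

end LineBundle

/-! ### Morphisms of line bundles from local expressions -/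

section Opens

variable {S : Scheme.{u}}

lemma exists_affine_hom_opensOver {U U' : S.Opens} {s : S} (h : s ∈ U) (h' : s ∈ U') :
    ∃ W : S.Opens, s ∈ W ∧ IsAffineOpen W ∧ Nonempty (opensOver W ⟶ opensOver U) ∧
      Nonempty (opensOver W ⟶ opensOver U') := by
  obtain ⟨W, hW, hs, hle⟩ := exists_isAffineOpen_mem_and_subset (U := U ⊓ U') ⟨h, h'⟩
  exact ⟨W, hs, hW, nonempty_hom_opensOver fun x => (hle x.2).1,
    nonempty_hom_opensOver fun x => (hle x.2).2⟩

lemma nontrivial_opensOver {U : S.Opens} {s : S} (h : s ∈ U) :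
    Nontrivial Γ((opensOver U).left, ⊤) := by
  have : Nonempty (⊤ : (U : Scheme.{u}).Opens) := ⟨⟨⟨s, h⟩, trivial⟩⟩
  exact Scheme.component_nontrivial (U : Scheme.{u}) ⊤

end Opens

namespace LineBundle

open Polynomial TopologicalSpace

variable {S : Scheme.{u}} {V W : LineBundle S}

theorem ClosedSubgroup.exists_localEq_natDegree [IsLocallyNoetherian S] [ConnectedSpace S]
    (G : V.ClosedSubgroup) (hfin : IsFinite G.obj.hom) (hflat : Flat G.obj.hom) :
    ∃ n, ∀ s : S, ∃ U : S.Opens, s ∈ U ∧ IsAffineOpen U ∧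
      ∃ (e : V.Frame U) (P : Γ(U, ⊤)[X]), G.LocalEq e.sec P ∧ P.natDegree = n := by
  choose U hs hU e P hP using G.exists_localEq hfin hflat
  have hdegree (s t : S) (hst : t ∈ U s) : (P t).natDegree = (P s).natDegree := by
    obtain ⟨W, hW, hWa, ⟨g⟩, ⟨g'⟩⟩ := exists_affine_hom_opensOver (hs t) hst
    have : IsAffine (W : Scheme.{u}) := hWa
    have := nontrivial_opensOver hW
    have hW := ((hP t).restrict g).natDegree_eq ((hP s).restrict g') ((e t).isBasis.comp g)
      ((e s).isBasis.comp g')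
    rwa [(hP t).1.natDegree_map, (hP s).1.natDegree_map] at hW
  have hconst : IsLocallyConstant fun s => (P s).natDegree :=
    (IsLocallyConstant.iff_exists_open _).2 fun s => ⟨U s, (U s).2, hs s, hdegree s⟩
  obtain ⟨s₀⟩ : Nonempty S := inferInstance
  exact ⟨(P s₀).natDegree, fun s => ⟨U s, hs s, hU s, e s, P s, hP s,
    hconst.apply_eq_of_preconnectedSpace s s₀⟩⟩

lemma ClosedSubgroup.hom_ext (G : V.ClosedSubgroup) {T : Over S} {y y' : T ⟶ G.obj}
    (h : y ≫ G.incl = y' ≫ G.incl) : y = y' := by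
  have := G.isClosedImmersion
  apply Over.OverMorphism.ext
  rw [← cancel_mono G.incl.left]
  exact congrArg (fun f => f.left) h

namespace LocalExpr

variable {T : Over S} [IsAffine T.left] {b : T ⟶ V.total} {b' : T ⟶ W.total}
  {f F : V.total ⟶ W.total} {P P' : Γ(T.left, ⊤)[X]}

lemma isAdditive (h : LocalExpr f b b' P) (hf : IsGroupHom f) (hb' : IsBasis b') :
    AdditivePolynomial.IsAdditive P := fun R' _ φ x y => by
  have hadd : P.eval₂ (specOverProj T φ).left.appTop.hom
        (specOverEquiv T φ x + specOverEquiv T φ y) =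
      P.eval₂ (specOverProj T φ).left.appTop.hom (specOverEquiv T φ x) +
        P.eval₂ (specOverProj T φ).left.appTop.hom (specOverEquiv T φ y) :=
    hb'.smul_injective (specOverProj T φ) (by rw [add_smul, ← h, ← h, ← h, add_smul, hf])
  rwa [← map_add, eval₂_specOverProj, eval₂_specOverProj, eval₂_specOverProj, ← map_add,
    EmbeddingLike.apply_eq_iff_eq] at hadd

lemma comp_C_mul_X {u v : Γ(T.left, ⊤)} (h : LocalExpr f (u • b) (v • b') P)
    (h' : LocalExpr f b b' P') (hb' : IsBasis b') : P'.comp (C u * X) = C v * P :=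
  (h'.smul u).unique hb' h.mul_left

lemma comp_C_mul_X_of_comp {u v : Γ(T.left, ⊤)} {D D' : Γ(T.left, ⊤)[X]}
    (h : LocalExpr f (u • b) (v • b') P) (h' : LocalExpr f b b' P')
    (hF : LocalExpr F (u • b) (v • b') (D.comp P)) (hF' : LocalExpr F b b' (D'.comp P'))
    (hb' : IsBasis b') (hP : P.Monic) (hd : P.natDegree ≠ 0) :
    D'.comp (C v * X) = C v * D := by
  refine AdditivePolynomial.comp_right_injective hP hd ?_
  have hcomp := hF.comp_C_mul_X hF' hb'
  rw [comp_assoc, h.comp_C_mul_X h' hb'] at hcomp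
  simpa only [comp_assoc, mul_comp, C_comp, X_comp] using hcomp

end LocalExpr

section Cover

variable {ι : Type u} {U : ι → S.Opens}

lemma ClosedSubgroup.exists_of_cover (hU : IsOpenCover U) (G : V.ClosedSubgroup) {T : Over S}
    (x : T ⟶ V.total)
    (h : ∀ (i : ι) (T' : Over S) (g : T' ⟶ T), (T' ⟶ opensOver (U i)) →
      ∃ y : T' ⟶ G.obj, y ≫ G.incl = g ≫ x) : ∃ y : T ⟶ G.obj, y ≫ G.incl = x := by
  choose y hy using fun i => h i _ (restrictIncl T (U i)) (restrictProj T (U i))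
  obtain ⟨z, hz⟩ := exists_glue hU y fun i j T' g g' _ hg => G.hom_ext (by
    rw [Category.assoc, Category.assoc, hy, hy, ← Category.assoc, ← Category.assoc, hg])
  refine ⟨z, over_hom_ext hU fun i T' g k => ?_⟩
  obtain ⟨k', rfl⟩ := exists_hom_restrictOver g k
  rw [Category.assoc, ← Category.assoc _ z, hz, hy, Category.assoc]

variable {e : ∀ i, V.Frame (U i)} {e' : ∀ i, W.Frame (U i)} {f f' : V.total ⟶ W.total}
  {P : ∀ i, Γ(U i, ⊤)[X]}

lemma isGroupHom_of_localExpr (hU : IsOpenCover U)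
    (h : ∀ i, LocalExpr f (e i).sec (e' i).sec (P i))
    (hP : ∀ i, AdditivePolynomial.IsAdditive (P i)) : IsGroupHom f := fun T x y => by
  refine over_hom_ext hU fun i T' g k => ?_
  obtain ⟨c, hc⟩ := (e i).isBasis.exists_smul k (g ≫ x)
  obtain ⟨d, hd⟩ := (e i).isBasis.exists_smul k (g ≫ y)
  rw [comp_add, ← Category.assoc, ← Category.assoc, ← Category.assoc, comp_add, hc, hd,
    ← add_smul, h i T' k, h i T' k, h i T' k, hP i, add_smul]

lemma hom_ext_of_localExpr (hU : IsOpenCover U)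
    (h : ∀ i, LocalExpr f (e i).sec (e' i).sec (P i))
    (h' : ∀ i, LocalExpr f' (e i).sec (e' i).sec (P i)) : f = f' :=
  over_hom_ext hU fun i T' g k => by
    obtain ⟨c, hc⟩ := (e i).isBasis.exists_smul k g
    rw [hc, h i T' k, h' i T' k]

variable {ξ : V.total ⟶ W.total}

lemma hom_ext_of_comp [∀ i, IsAffine (opensOver (U i)).left] (hU : IsOpenCover U)
    (hξ : ∀ i, LocalExpr ξ (e i).sec (e' i).sec (P i)) (hP : ∀ i, (P i).Monic)
    (hd : ∀ i, (P i).natDegree ≠ 0) {f f' : W.total ⟶ W.total} (h : ξ ≫ f = ξ ≫ f') : f = f' := by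
  choose D hD using fun i => exists_localExpr f (e' i).sec (e' i).isBasis
  choose D' hD' using fun i => exists_localExpr f' (e' i).sec (e' i).isBasis
  have hDD' (i : ι) : D i = D' i :=
    AdditivePolynomial.comp_right_injective (hP i) (hd i) <|
      ((hξ i).comp (hD i)).unique (e' i).isBasis (h ▸ (hξ i).comp (hD' i))
  exact hom_ext_of_localExpr hU hD fun i => hDD' i ▸ hD' i

theorem exists_factor (hU : IsOpenCover U)
    (hξ : ∀ i, LocalExpr ξ (e i).sec (e' i).sec (P i)) (hP : ∀ i, (P i).Monic)
    (hd : ∀ i, (P i).natDegree ≠ 0) {F : V.total ⟶ W.total} {D : ∀ i, Γ(U i, ⊤)[X]}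
    (hF : ∀ i, LocalExpr F (e i).sec (e' i).sec ((D i).comp (P i))) :
    ∃ f : W.total ⟶ W.total, ξ ≫ f = F ∧ ∀ i, LocalExpr f (e' i).sec (e' i).sec (D i) := by
  obtain ⟨f, hf⟩ := exists_hom_of_localExpr (e := e') (e' := e') (P := D) hU
    fun i j T g g' c c' hT hc => by
      rcases subsingleton_or_nontrivial Γ(T.left, ⊤) with hsub | hnontriv
      · have := Module.subsingleton Γ(T.left, ⊤) (T ⟶ W.total)
        exact Subsingleton.elim _ _
      have hb' := (e' j).isBasis.comp g'
      obtain ⟨u, hu⟩ := ((e i).isBasis.comp g).exists_unit ((e j).isBasis.comp g')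
      obtain ⟨v, hv⟩ := ((e' i).isBasis.comp g).exists_unit hb'
      have hF_i := (hF i).restrict g
      have hF_j := (hF j).restrict g'
      rw [Polynomial.map_comp] at hF_i hF_j
      have htransition := LocalExpr.comp_C_mul_X_of_comp (hu ▸ hv ▸ (hξ i).restrict g)
        ((hξ j).restrict g') (hu ▸ hv ▸ hF_i) hF_j hb' ((hP i).map _)
        (((hP i).natDegree_map _).trans_ne (hd i))
      have hc' : c * v = c' := hb'.smul_injective (𝟙 T) <| by
        rw [Category.id_comp, ← hc, hv, smul_smul]
      have heval := congrArg (Polynomial.eval c) htransition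
      rw [eval_comp, eval_mul, eval_C, eval_X, eval_mul, eval_C, Polynomial.eval_map,
        Polynomial.eval_map] at heval
      rw [hv, smul_smul, ← hc', mul_comm c, heval, mul_comm]
  exact ⟨f, hom_ext_of_localExpr hU (fun i => (hξ i).comp (hf i)) hF, hf⟩

end Cover

end LineBundle

/-! ### Drinfeld modules in local coordinates -/

section

open Polynomial

variable {S : Scheme.{u}}

lemma LineBundle.comp_zero (V : LineBundle S) {T T' : Over S} (g : T' ⟶ T) :
    g ≫ (0 : T ⟶ V.total) = 0 := by
  have h := V.comp_smul g 0 0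
  rwa [zero_smul, map_zero, zero_smul] at h

variable {Fq : Type u} [Field Fq] {A : Type u} [CommRing A] [Algebra Fq A]
  {γ : S ⟶ Spec (CommRingCat.of A)}

lemma appTop_gammaSharp {T T' : Over S} (g : T' ⟶ T) (a : A) :
    g.left.appTop.hom (gammaSharp (T.hom ≫ γ) a) = gammaSharp (T'.hom ≫ γ) a := by
  rw [← Over.w g, Category.assoc]
  rfl

variable (Fq) in
/-- The structure morphism from `𝔽_q` to the global functions of an `A`-scheme. -/
noncomputable def scalarHom (γ : S ⟶ Spec (CommRingCat.of A)) : Fq →+* Γ(S, ⊤) :=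
  (gammaSharp γ).comp (algebraMap Fq A)

variable (Fq) in
lemma natCast_gamma_eq_zero {p : ℕ} [CharP Fq p] (γ : S ⟶ Spec (CommRingCat.of A)) :
    (p : Γ(S, ⊤)) = 0 := by
  rw [← map_natCast (scalarHom Fq γ), CharP.cast_eq_zero, map_zero]

namespace DrinfeldModule

open LineBundle

variable [Fintype Fq] {r : ℕ} {E : DrinfeldModule Fq γ r}

lemma act_zero (E : DrinfeldModule Fq γ r) : E.act 0 = 0 := by
  have h := E.act_add 0 0 _ (𝟙 _)
  rw [Category.id_comp, add_zero] at h
  exact left_eq_add.1 h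

lemma localExpr_algebraMap {T : Over S} (b : T ⟶ E.bundle.total) (c : Fq) :
    LocalExpr (E.act (algebraMap Fq A c)) b b (C (scalarHom Fq (T.hom ≫ γ) c) * X) :=
  fun T' g d => by
    rw [E.act_algebraMap, smul_smul, eval₂_mul, eval₂_C, eval₂_X]
    congr 2
    exact (appTop_gammaSharp g _).symm

lemma dvd_comp_act {G : E.bundle.ClosedSubgroup} (hinv : G.IsInvariant) {T : Over S}
    [IsAffine T.left] {b : T ⟶ E.bundle.total} {P : Γ(T.left, ⊤)[X]} (hP : G.LocalEq b P)
    {a : A} {φ : Γ(T.left, ⊤)[X]} (hφ : LocalExpr (E.act a) b b φ) : P ∣ P.comp φ :=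
  dvd_of_forall_eval₂ fun T' g c hc => by
    obtain ⟨y, hy⟩ := (hP.2 T' g c).2 hc
    obtain ⟨z, hz⟩ := hinv a T' y
    rw [eval₂_comp]
    exact (hP.2 T' g _).1 ⟨z, by rw [hz, hy, hφ]⟩

variable {U : S.Opens} [hU : IsAffine (U : Scheme.{u})] {e : E.bundle.Frame U}

lemma coeff_one {a : A} {φ : Γ(U, ⊤)[X]} (h : LocalExpr (E.act a) e.sec e.sec φ) :
    φ.coeff 1 = U.ι.appTop.hom (gammaSharp γ a) := by
  rcases eq_or_ne a 0 with rfl | ha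
  · have hzero : LocalExpr (E.act 0) e.sec e.sec (0 : Γ((opensOver U).left, ⊤)[X]) :=
      fun T' g c => by rw [act_zero, comp_zero, eval₂_zero, zero_smul]
    rw [h.unique e.isBasis hzero, Polynomial.coeff_zero, map_zero, map_zero]
  · exact E.derivative a ha U hU e φ h

variable {G : E.bundle.ClosedSubgroup} {P : Γ(U, ⊤)[X]} {h : ℕ}

lemma comp_C_mul_X (hP : G.LocalEq e.sec P) (hinv : G.IsInvariant)
    (hreg : G.CoeffRegular (Fintype.card Fq) h) (c : Fq) :
    P.comp (C (scalarHom Fq (U.ι ≫ γ) c) * X) = C (scalarHom Fq (U.ι ≫ γ) c) * P :=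
  AdditivePolynomial.comp_C_mul_X_eq hP.1
    (dvd_comp_act (T := opensOver U) hinv hP (localExpr_algebraMap e.sec c))
    (hreg U hU e P hP) (by rw [← map_pow, FiniteField.pow_card_pow])

lemma isAdditive_of_localEq (hP : G.LocalEq e.sec P) : AdditivePolynomial.IsAdditive P := by
  obtain ⟨p, hchar⟩ := CharP.exists Fq
  exact ClosedSubgroup.LocalEq.isAdditive (T := opensOver U) hP (CharP.char_is_prime Fq p)
    (natCast_gamma_eq_zero Fq (U.ι ≫ γ))

lemma X_pow_dvd (hP : G.LocalEq e.sec P) (hinv : G.IsInvariant)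
    (hh : G.HasHeight (Fintype.card Fq) h) (hreg : G.CoeffRegular (Fintype.card Fq) h) :
    X ^ Fintype.card Fq ^ h ∣ P :=
  AdditivePolynomial.X_pow_dvd_of_coeff Fintype.one_lt_card
    ((isAdditive_of_localEq hP).exists_eq_card_pow (scalarHom Fq (U.ι ≫ γ))
      (comp_C_mul_X hP hinv hreg))
    fun i hi => hh.1 i hi U hU e P hP

end DrinfeldModule

end

/-! ### Properties checked on a cover by frames -/

section

open Polynomial TopologicalSpace

variable {S : Scheme.{u}}

lemma appTop_appTop_hom {T T' : Over S} (g : T' ⟶ T) (c : Γ(S, ⊤)) :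
    g.left.appTop.hom (T.hom.appTop.hom c) = T'.hom.appTop.hom c :=
  congr(($(Over.w g)).appTop.hom c)

namespace LineBundle

variable {V W : LineBundle S} {ι : Type u} {U : ι → S.Opens} {e : ∀ i, V.Frame (U i)}
  {e' : ∀ i, W.Frame (U i)} {P : ∀ i, Γ(U i, ⊤)[X]}

lemma hasDerivativeAtZero_of_localExpr (hU : IsOpenCover U) {f : V.total ⟶ V.total}
    (hP : ∀ i, LocalExpr f (e i).sec (e i).sec (P i)) {c : Γ(S, ⊤)}
    (hc : ∀ i, (P i).coeff 1 = (U i).ι.appTop.hom c) : HasDerivativeAtZero f c := by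
  intro U₀ _ ε Q hQ
  refine appTop_ext hU (T := opensOver U₀) fun i T g k hT => ?_
  have hbasis := (e i).isBasis.comp k
  obtain ⟨u, hu⟩ := (ε.isBasis.comp g).exists_unit hbasis
  have hQT := LocalExpr.restrict (T := opensOver U₀) hQ g
  rw [hu] at hQT
  have htransition := congrArg (fun F => F.coeff 1)
    (hQT.comp_C_mul_X ((hP i).restrict k) hbasis)
  simp only [comp_C_mul_X_coeff, coeff_C_mul, coeff_map, pow_one, hc, mul_comm _ u.1]
    at htransition
  exact (u.mul_right_inj.1 htransition).symm.trans
    ((appTop_appTop_hom k c).trans (appTop_appTop_hom g c).symm)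

lemma isKernel_of_localEq (hU : IsOpenCover U) {G : V.ClosedSubgroup} {ξ : V.total ⟶ W.total}
    (hξ : ∀ i, LocalExpr ξ (e i).sec (e' i).sec (P i))
    (hP : ∀ i, G.LocalEq (e i).sec (P i)) : G.IsKernel ξ := by
  have hlocal (i : ι) {T : Over S} (g : T ⟶ opensOver (U i)) (x : T ⟶ V.total) :
      (∃ y : T ⟶ G.obj, y ≫ G.incl = x) ↔ x ≫ ξ = 0 := by
    obtain ⟨c, rfl⟩ := (e i).isBasis.exists_smul g x
    rw [(hP i).2 T g c, hξ i T g c, (e' i).isBasis.smul_eq_zero_iff]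
  intro T x
  constructor
  · rintro ⟨y, rfl⟩
    refine over_hom_ext hU fun i T' g k => ?_
    rw [W.comp_zero, ← Category.assoc]
    exact (hlocal i k _).1 ⟨g ≫ y, Category.assoc _ _ _⟩
  · intro hx
    refine G.exists_of_cover hU x fun i T' g k => (hlocal i k _).2 ?_
    rw [Category.assoc, hx, W.comp_zero]

lemma smul_comp_of_localExpr (hU : IsOpenCover U) {f : V.total ⟶ W.total}
    (hf : ∀ i, LocalExpr f (e i).sec (e' i).sec (P i)) {c : Γ(S, ⊤)}
    (hc : ∀ i, (P i).comp (C ((U i).ι.appTop.hom c) * X) = C ((U i).ι.appTop.hom c) * P i)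
    {T : Over S} (x : T ⟶ V.total) :
    (T.hom.appTop.hom c • x) ≫ f = T.hom.appTop.hom c • (x ≫ f) := by
  refine over_hom_ext hU fun i T' g k => ?_
  have hcT : g.left.appTop.hom (T.hom.appTop.hom c) = k.left.appTop.hom ((U i).ι.appTop.hom c) :=
    (appTop_appTop_hom g c).trans (appTop_appTop_hom k c).symm
  obtain ⟨d, hd⟩ := (e i).isBasis.exists_smul k (g ≫ x)
  have heval := congrArg (eval₂ k.left.appTop.hom d) (hc i)
  rw [eval₂_comp, eval₂_mul, eval₂_mul, eval₂_C, eval₂_X] at heval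
  rw [comp_smul, ← Category.assoc, ← Category.assoc, comp_smul, hd, hcT, smul_smul, hf i T' k,
    hf i T' k, smul_smul, ← heval]

end LineBundle

namespace DrinfeldModule

open LineBundle AdditivePolynomial

variable {Fq : Type u} [Field Fq] [Fintype Fq] {A : Type u} [CommRing A] [Algebra Fq A]
  {γ : S ⟶ Spec (CommRingCat.of A)} {r : ℕ} {E : DrinfeldModule Fq γ r} {a : A}

section

variable {U : S.Opens} [IsAffine (U : Scheme.{u})] {e : E.bundle.Frame U} {φ : Γ(U, ⊤)[X]}

lemma finite_localExpr_act (ha : a ≠ 0) (hφ : LocalExpr (E.act a) e.sec e.sec φ) :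
    (compRingHom φ).Finite :=
  LocalExpr.finite (T := opensOver U) hφ e.isBasis e.isBasis (E.finite a ha)

lemma flat_localExpr_act (ha : a ≠ 0) (hφ : LocalExpr (E.act a) e.sec e.sec φ) :
    (compRingHom φ).Flat :=
  LocalExpr.flat (T := opensOver U) hφ e.isBasis e.isBasis (E.flat a ha)

lemma natDegree_map_localExpr_act (ha : a ≠ 0) (hφ : LocalExpr (E.act a) e.sec e.sec φ)
    (x : PrimeSpectrum Γ(U, ⊤)[X]) :
    (φ.map ((algebraMap Γ(U, ⊤)[X] x.asIdeal.ResidueField).comp C)).natDegree =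
      Fintype.card Fq ^ (r * Module.finrank Fq (A ⧸ Ideal.span {a})) := by
  rw [← finrank_compRingHom (finite_localExpr_act ha hφ) (flat_localExpr_act ha hφ) x,
    ← E.finrank_eq a ha]
  exact (LocalExpr.finrank (T := opensOver U) hφ e.isBasis e.isBasis (E.finite a ha)
    (E.flat a ha) x).symm

end

variable {W : LineBundle S} {ι : Type u} {U : ι → S.Opens} [∀ i, IsAffine (U i : Scheme.{u})]
  {e : ∀ i, E.bundle.Frame (U i)} {e' : ∀ i, W.Frame (U i)} {P φ D : ∀ i, Γ(U i, ⊤)[X]}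

lemma finite_flat_finrank_of_localExpr (hU : IsOpenCover U) (hP : ∀ i, (P i).Monic)
    (hd : ∀ i, (P i).natDegree ≠ 0) (ha : a ≠ 0)
    (hφ : ∀ i, LocalExpr (E.act a) (e i).sec (e i).sec (φ i)) {f : W.total ⟶ W.total}
    (hf : ∀ i, LocalExpr f (e' i).sec (e' i).sec (D i))
    (hD : ∀ i, (P i).comp (φ i) = (D i).comp (P i)) :
    IsFinite f.left ∧ Flat f.left ∧ ∀ y, f.left.finrank y =
      Fintype.card Fq ^ (r * Module.finrank Fq (A ⧸ Ideal.span {a})) := by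
  have hfinflat (i : ι) := finite_and_flat_compRingHom_of_comp_eq (hP i) (hd i)
    (finite_localExpr_act ha (hφ i)) (flat_localExpr_act ha (hφ i)) (hD i)
  refine ⟨isFinite_of_localExpr hU hf fun i => (hfinflat i).1,
    flat_of_localExpr hU hf fun i => (hfinflat i).2,
    finrank_of_localExpr hU hf (fun i => (hfinflat i).1) (fun i => (hfinflat i).2) fun i x => ?_⟩
  rw [finrank_compRingHom (hfinflat i).1 (hfinflat i).2 x,
    natDegree_map_eq_of_comp_eq (hP i) (hd i) (hD i), natDegree_map_localExpr_act ha (hφ i) x]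

end DrinfeldModule

end

/-! ### Isogenies with kernel `G` -/

section

open Polynomial TopologicalSpace LineBundle

variable {S : Scheme.{u}} {Fq : Type u} [Field Fq] {A : Type u} [CommRing A] [Algebra Fq A]
  {γ : S ⟶ Spec (CommRingCat.of A)}

namespace LineBundle

variable {V W : LineBundle S} {G : V.ClosedSubgroup}

lemma ClosedSubgroup.IsKernel.associated {ξ : V.total ⟶ W.total} (hξ : G.IsKernel ξ) {T : Over S}
    [IsAffine T.left] {b : T ⟶ V.total} {b' : T ⟶ W.total} (hb' : IsBasis b')
    {P Q : Γ(T.left, ⊤)[X]} (hP : G.LocalEq b P) (hQ : LocalExpr ξ b b' Q) : Associated P Q := by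
  have hroots (T' : Over S) (g : T' ⟶ T) (c : Γ(T'.left, ⊤)) :
      P.eval₂ g.left.appTop.hom c = 0 ↔ Q.eval₂ g.left.appTop.hom c = 0 := by
    rw [← hP.2 T' g c, hξ T', hQ T' g c, hb'.smul_eq_zero_iff]
  exact AdditivePolynomial.associated_of_dvd_of_dvd hP.1
    (dvd_of_forall_eval₂ fun T' g c => (hroots T' g c).1)
    (dvd_of_forall_eval₂ fun T' g c => (hroots T' g c).2)

lemma ClosedSubgroup.exists_frames_localEq [IsLocallyNoetherian S] (G : V.ClosedSubgroup)
    (W : LineBundle S) (hfin : IsFinite G.obj.hom) (hflat : Flat G.obj.hom) (s : S) :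
    ∃ U : S.Opens, s ∈ U ∧ IsAffineOpen U ∧
      ∃ (e : V.Frame U) (_ : W.Frame U) (P : Γ(U, ⊤)[X]), G.LocalEq e.sec P := by
  obtain ⟨U₁, hs₁, -, e, P, hP⟩ := G.exists_localEq hfin hflat s
  obtain ⟨U₂, hs₂, -, e', he'⟩ := W.exists_frame s
  obtain ⟨U, hs, hU, ⟨g⟩, ⟨g'⟩⟩ := exists_affine_hom_opensOver hs₁ hs₂
  exact ⟨U, hs, hU, e.restrict g, Frame.restrict ⟨e', he'⟩ g', _, hP.restrict g⟩

lemma isFqLinearHom_of_localExpr {ι : Type u} {U : ι → S.Opens} (hU : IsOpenCover U)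
    {e : ∀ i, V.Frame (U i)} {e' : ∀ i, W.Frame (U i)} {P : ∀ i, Γ(U i, ⊤)[X]}
    {f : V.total ⟶ W.total} (hf : ∀ i, LocalExpr f (e i).sec (e' i).sec (P i))
    (hadd : ∀ i, AdditivePolynomial.IsAdditive (P i))
    (hlin : ∀ i c, (P i).comp (C (scalarHom Fq ((U i).ι ≫ γ) c) * X) =
      C (scalarHom Fq ((U i).ι ≫ γ) c) * P i) : IsFqLinearHom Fq γ f :=
  ⟨isGroupHom_of_localExpr hU hf hadd, fun c _ x =>
    smul_comp_of_localExpr (c := scalarHom Fq γ c) hU hf (fun i => hlin i c) x⟩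

/-- The frame of the Frobenius twist given by a frame of `V`. -/
noncomputable def Frame.twist {p : ℕ} (hp : p.Prime) (k : ℕ) (hS : (p : Γ(S, ⊤)) = 0)
    {U : S.Opens} (e : V.Frame U) : (V.twist hp k hS).Frame U :=
  ⟨e.sec ≫ V.toTwist hp k hS, e.isBasis.comp_toTwist hp k hS⟩

theorem ClosedSubgroup.exists_hom_twist {ι : Type u} {U : ι → S.Opens} (hU : IsOpenCover U)
    {e : ∀ i, V.Frame (U i)} {P : ∀ i, Γ(U i, ⊤)[X]} (hP : ∀ i, G.LocalEq (e i).sec (P i))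
    {p : ℕ} (hp : p.Prime) {k : ℕ} (hd : ∀ i, (P i).natDegree = p ^ k) (hS : (p : Γ(S, ⊤)) = 0) :
    ∃ ξ : V.total ⟶ (V.twist hp k hS).total,
      ∀ i, LocalExpr ξ (e i).sec ((e i).twist hp k hS).sec (P i) := by
  refine exists_hom_of_localExpr hU fun i j T g g' c c' hT hc => ?_
  rcases subsingleton_or_nontrivial Γ(T.left, ⊤) with hsub | hnontriv
  · have := Module.subsingleton Γ(T.left, ⊤) (T ⟶ (V.twist hp k hS).total)
    exact Subsingleton.elim _ _
  obtain ⟨u, hu⟩ := ((e i).isBasis.comp g).exists_unit ((e j).isBasis.comp g')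
  have hc' : u * c = c' := ((e j).isBasis.comp g').smul_injective (𝟙 T) <| by
    rw [Category.id_comp, ← hc, hu, smul_smul, mul_comm]
  have heval := ClosedSubgroup.LocalEq.eval₂_eq (hu ▸ (hP i).restrict g) ((hP j).restrict g') c
  rw [(hP i).1.natDegree_map, hd, Polynomial.eval_map, Polynomial.eval_map, hc'] at heval
  rw [Frame.twist, Frame.twist, ← Category.assoc, hu, smul_comp_toTwist, smul_smul, heval,
    mul_comm, Category.assoc]

end LineBundle

namespace DrinfeldModule

variable [Fintype Fq] {r : ℕ} {E : DrinfeldModule Fq γ r}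

section Induced

variable {W : LineBundle S} {ξ : E.bundle.total ⟶ W.total} {f : A → (W.total ⟶ W.total)}
  (hcancel : ∀ {g g' : W.total ⟶ W.total}, ξ ≫ g = ξ ≫ g' → g = g')
  (hf : ∀ a, ξ ≫ f a = E.act a ≫ ξ)

include hcancel hf

lemma induced_act_one : f 1 = 𝟙 W.total :=
  hcancel (by rw [hf, E.act_one, Category.id_comp, Category.comp_id])

lemma induced_act_mul (a b : A) : f (a * b) = f b ≫ f a :=
  hcancel (by rw [hf, E.act_mul, ← Category.assoc, hf, Category.assoc, Category.assoc, hf])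

lemma induced_act_add (hξ : IsGroupHom ξ) (a b : A) : f (a + b) = f a + f b :=
  hcancel (by
    have hadd := E.act_add a b _ (𝟙 _)
    rw [Category.id_comp, Category.id_comp, Category.id_comp] at hadd
    rw [hf, hadd, hξ, W.comp_add, hf, hf])

lemma comp_induced_act_algebraMap (hξ : IsFqLinearHom Fq γ ξ) (c : Fq) {T : Over S}
    (x : T ⟶ W.total) : x ≫ f (algebraMap Fq A c) =
      gammaSharp (T.hom ≫ γ) (algebraMap Fq A c) • x := by
  have hscalar : f (algebraMap Fq A c) =
      gammaSharp (W.total.hom ≫ γ) (algebraMap Fq A c) • 𝟙 W.total := hcancel (by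
    have hact := E.act_algebraMap c _ (𝟙 _)
    rw [Category.id_comp] at hact
    rw [hf, hact, hξ.2, Category.id_comp, W.comp_smul, appTop_gammaSharp, Category.comp_id])
  rw [hscalar, W.comp_smul, appTop_gammaSharp, Category.comp_id]

lemma isFqLinearHom_induced_act (hξ : IsFqLinearHom Fq γ ξ) {a : A} (ha : IsGroupHom (f a)) :
    IsFqLinearHom Fq γ (f a) :=
  ⟨ha, fun c _ x => by
    rw [← comp_induced_act_algebraMap hcancel hf hξ, ← comp_induced_act_algebraMap hcancel hf hξ,
      Category.assoc, Category.assoc, ← induced_act_mul hcancel hf,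
      ← induced_act_mul hcancel hf, mul_comm]⟩

end Induced

variable {G : E.bundle.ClosedSubgroup} {h : ℕ}

/-- The induced action is an action because `ξ` can be cancelled on the left. -/
theorem exists_isogeny_of_localExpr {W : LineBundle S} {ι : Type u} {U : ι → S.Opens}
    (hU : IsOpenCover U) [∀ i, IsAffine (U i : Scheme.{u})] {e : ∀ i, E.bundle.Frame (U i)}
    {e' : ∀ i, W.Frame (U i)} {P : ∀ i, Γ(U i, ⊤)[X]} (hP : ∀ i, G.LocalEq (e i).sec (P i))
    (hd : ∀ i, (P i).natDegree ≠ 0) {ξ : E.bundle.total ⟶ W.total}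
    (hξ : ∀ i, LocalExpr ξ (e i).sec (e' i).sec (P i)) (hξlin : IsFqLinearHom Fq γ ξ)
    (hD : ∀ a i, ∃ φ D : Γ(U i, ⊤)[X], LocalExpr (E.act a) (e i).sec (e i).sec φ ∧
      AdditivePolynomial.IsAdditive D ∧ (P i).comp φ = D.comp (P i) ∧
      D.coeff 1 = (U i).ι.appTop.hom (gammaSharp γ a)) :
    ∃ (F : DrinfeldModule Fq γ r) (ξ : Isogeny E F), G.IsKernel ξ.hom := by
  have hmonic (i : ι) : (P i).Monic := (hP i).1
  choose φ D hφ hDadd hcomp hderiv using hD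
  choose f hf hfD using fun a => exists_factor hU hξ hmonic hd fun i =>
    hcomp a i ▸ (hφ a i).comp (hξ i)
  have hcancel {g g' : W.total ⟶ W.total} (h : ξ ≫ g = ξ ≫ g') : g = g' :=
    hom_ext_of_comp hU hξ hmonic hd h
  have hrank (a : A) (ha : a ≠ 0) :=
    finite_flat_finrank_of_localExpr hU hmonic hd ha (hφ a) (hfD a) (hcomp a)
  let F : DrinfeldModule Fq γ r :=
    { rank_pos := E.rank_pos
      bundle := W
      act := f
      isFqLinearHom := fun a => isFqLinearHom_induced_act hcancel hf hξlin
        (isGroupHom_of_localExpr hU (hfD a) (hDadd a))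
      act_one := induced_act_one hcancel hf
      act_mul := induced_act_mul hcancel hf
      act_add := fun a b _ x => by rw [induced_act_add hcancel hf hξlin.1, W.comp_add]
      act_algebraMap := fun c _ x => comp_induced_act_algebraMap hcancel hf hξlin c x
      derivative := fun a _ => hasDerivativeAtZero_of_localExpr hU (hfD a) (hderiv a)
      finite := fun a ha => (hrank a ha).1
      flat := fun a ha => (hrank a ha).2.1
      finrank_eq := fun a ha => (hrank a ha).2.2 }
  let isogeny : Isogeny E F :=
    { hom := ξ
      isGroupHom := hξlin.1
      finite := isFinite_of_localExpr hU hξ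
        fun i => AdditivePolynomial.finite_compRingHom (hmonic i) (hd i)
      comm := fun a => (hf a).symm }
  exact ⟨F, isogeny, isKernel_of_localEq hU hξ hP⟩

section Local

variable {U : S.Opens} [IsAffine (U : Scheme.{u})] {e : E.bundle.Frame U} {P : Γ(U, ⊤)[X]}

theorem exists_induced_localExpr (hinv : G.IsInvariant) (hh : G.HasHeight (Fintype.card Fq) h)
    (hreg : G.CoeffRegular (Fintype.card Fq) h) (hP : G.LocalEq e.sec P) {a : A}
    (ha : gammaSharp γ a ^ Fintype.card Fq ^ h = gammaSharp γ a) :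
    ∃ φ D : Γ(U, ⊤)[X], LocalExpr (E.act a) e.sec e.sec φ ∧ AdditivePolynomial.IsAdditive D ∧
      P.comp φ = D.comp P ∧ D.coeff 1 = U.ι.appTop.hom (gammaSharp γ a) := by
  obtain ⟨p, hchar⟩ := CharP.exists Fq
  obtain ⟨φ, hφ⟩ := exists_localExpr (T := opensOver U) (E.act a) e.sec e.isBasis
  have hPadd := isAdditive_of_localEq hP
  have hφadd : AdditivePolynomial.IsAdditive φ :=
    hφ.isAdditive (E.isFqLinearHom a).1 e.isBasis
  obtain ⟨D, hDadd, hD⟩ := AdditivePolynomial.IsAdditive.exists_eq_comp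
    (CharP.char_is_prime Fq p) (natCast_gamma_eq_zero Fq (U.ι ≫ γ)) hP.1 hPadd
    (hPadd.comp hφadd) (dvd_comp_act hinv hP hφ)
  refine ⟨φ, D, hφ, hDadd, hD, ?_⟩
  rw [AdditivePolynomial.coeff_one_eq_pow_of_comp_eq (X_pow_dvd hP hinv hh hreg)
    (pow_ne_zero h Fintype.card_ne_zero) (hreg U ‹_› e P hP) hφadd.coeff_zero hDadd.coeff_zero hD,
    coeff_one hφ, ← map_pow, ha]

theorem appTop_gammaSharp_pow_eq (hinv : G.IsInvariant) (hh : G.HasHeight (Fintype.card Fq) h)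
    (hreg : G.CoeffRegular (Fintype.card Fq) h) (hP : G.LocalEq e.sec P)
    {F : DrinfeldModule Fq γ r} (e' : F.bundle.Frame U) {ξ : Isogeny E F} (hξ : G.IsKernel ξ.hom)
    (a : A) : U.ι.appTop.hom (gammaSharp γ a ^ Fintype.card Fq ^ h) =
      U.ι.appTop.hom (gammaSharp γ a) := by
  obtain ⟨Q, hQ⟩ := exists_localExpr (T := opensOver U) ξ.hom e.sec e'.isBasis
  obtain ⟨φ, hφ⟩ := exists_localExpr (T := opensOver U) (E.act a) e.sec e.isBasis
  obtain ⟨ψ, hψ⟩ := exists_localExpr (T := opensOver U) (F.act a) e'.sec e'.isBasis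
  have hPQ : Associated P Q := hξ.associated (T := opensOver U) e'.isBasis hP hQ
  have hX := X_pow_dvd hP hinv hh hreg
  have hcomm : Q.comp φ = ψ.comp Q :=
    (ξ.comm a ▸ hφ.comp hQ).unique e'.isBasis (hQ.comp hψ)
  have hderiv := AdditivePolynomial.coeff_one_eq_pow_of_comp_eq (hX.trans hPQ.dvd)
    (pow_ne_zero h Fintype.card_ne_zero)
    (AdditivePolynomial.coeff_mem_nonZeroDivisors_of_associated hPQ hX (hreg U ‹_› e P hP))
    (hφ.isAdditive (E.isFqLinearHom a).1 e.isBasis).coeff_zero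
    (hψ.isAdditive (F.isFqLinearHom a).1 e'.isBasis).coeff_zero hcomm
  rw [map_pow, ← coeff_one hφ, ← hderiv, coeff_one hψ, coeff_one hφ]

end Local

theorem gammaSharp_pow_eq [IsLocallyNoetherian S] (hfin : IsFinite G.obj.hom)
    (hflat : Flat G.obj.hom) (hinv : G.IsInvariant) (hh : G.HasHeight (Fintype.card Fq) h)
    (hreg : G.CoeffRegular (Fintype.card Fq) h) {F : DrinfeldModule Fq γ r} (ξ : Isogeny E F)
    (hξ : G.IsKernel ξ.hom) (a : A) :
    gammaSharp γ a ^ Fintype.card Fq ^ h = gammaSharp γ a := by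
  choose U hs hU e e' P hP using G.exists_frames_localEq F.bundle hfin hflat
  exact global_ext (isOpenCover_of_forall_mem hs) fun s =>
      have : IsAffine (U s : Scheme.{u}) := hU s
      appTop_gammaSharp_pow_eq hinv hh hreg (hP s) (e' s) hξ a

theorem exists_isogeny_of_gammaSharp_pow_eq [IsLocallyNoetherian S] [ConnectedSpace S]
    (hfin : IsFinite G.obj.hom) (hflat : Flat G.obj.hom) (hinv : G.IsInvariant)
    (hh : G.HasHeight (Fintype.card Fq) h) (hreg : G.CoeffRegular (Fintype.card Fq) h)
    (hγ : ∀ a : A, gammaSharp γ a ^ Fintype.card Fq ^ h = gammaSharp γ a) :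
    ∃ (F : DrinfeldModule Fq γ r) (ξ : Isogeny E F), G.IsKernel ξ.hom := by
  obtain ⟨p, hchar⟩ := CharP.exists Fq
  have hp : p.Prime := CharP.char_is_prime Fq p
  obtain ⟨n, hn⟩ := G.exists_localEq_natDegree hfin hflat
  choose U hs hU e P hP hPn using hn
  have hcover : IsOpenCover U := isOpenCover_of_forall_mem hs
  have (i : S) : IsAffine (U i : Scheme.{u}) := hU i
  obtain ⟨k, rfl⟩ : ∃ k, n = p ^ k := by
    obtain ⟨s⟩ : Nonempty S := inferInstance
    have : Nontrivial Γ((opensOver (U s)).left, ⊤) := nontrivial_opensOver (hs s)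
    obtain ⟨k, hk⟩ := (isAdditive_of_localEq (hP s)).exists_natDegree_eq_pow hp
      (natCast_gamma_eq_zero Fq ((U s).ι ≫ γ)) (hP s).1.ne_zero
    exact ⟨k, (hPn s).symm.trans hk⟩
  obtain ⟨ξ, hξ⟩ := ClosedSubgroup.exists_hom_twist hcover hP hp hPn (natCast_gamma_eq_zero Fq γ)
  refine exists_isogeny_of_localExpr hcover hP (fun i => ?_) hξ
    (isFqLinearHom_of_localExpr hcover hξ (fun i => isAdditive_of_localEq (hP i))
      fun i c => comp_C_mul_X (hP i) hinv hreg c)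
    fun a i => exists_induced_localExpr hinv hh hreg (hP i) (hγ a)
  rw [hPn]
  exact pow_ne_zero k hp.ne_zero

end DrinfeldModule

end

theorem mainTheorem11_general {Fq : Type u} [Field Fq] [Fintype Fq] {A : Type u} [CommRing A]
    [Algebra Fq A] {S : Scheme.{u}} [IsLocallyNoetherian S] [ConnectedSpace S]
    (γ : S ⟶ Spec (CommRingCat.of A)) {r : ℕ} (E : DrinfeldModule Fq γ r)
    (G : E.bundle.ClosedSubgroup) (hfin : IsFinite G.obj.hom) (hflat : Flat G.obj.hom)
    (hinv : G.IsInvariant) (h : ℕ) (hh : G.HasHeight (Fintype.card Fq) h)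
    (hreg : G.CoeffRegular (Fintype.card Fq) h) :
    (∃ (F : DrinfeldModule Fq γ r) (ξ : Isogeny E F), G.IsKernel ξ.hom) ↔
      ∀ a : A, gammaSharp γ (a ^ Fintype.card Fq ^ h) = gammaSharp γ a := by
  simp only [map_pow]
  exact ⟨fun ⟨_, ξ, hξ⟩ => DrinfeldModule.gammaSharp_pow_eq hfin hflat hinv hh hreg ξ hξ,
    DrinfeldModule.exists_isogeny_of_gammaSharp_pow_eq hfin hflat hinv hh hreg⟩

theorem mainTheorem11 {Fq : Type u} [Field Fq] [Fintype Fq] {A : Type u} [CommRing A]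
    [Algebra Fq A] (hA : IsCurveCoordinateRing Fq A)
    {S : Scheme.{u}} [IsLocallyNoetherian S] [ConnectedSpace S]
    (γ : S ⟶ Spec (CommRingCat.of A)) {r : ℕ} (E : DrinfeldModule Fq γ r)
    (G : E.bundle.ClosedSubgroup) (hfin : IsFinite G.obj.hom) (hflat : Flat G.obj.hom)
    (hinv : G.IsInvariant) (h : ℕ) (hh : G.HasHeight (Fintype.card Fq) h)
    (hreg : G.CoeffRegular (Fintype.card Fq) h) :
    (∃ (F : DrinfeldModule Fq γ r) (ξ : Isogeny E F), G.IsKernel ξ.hom) ↔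
      ∀ a : A, gammaSharp γ (a ^ Fintype.card Fq ^ h) = gammaSharp γ a :=
  mainTheorem11_general γ E G hfin hflat hinv h hh hreg
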